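/- **Theorem (Online Local Edge Coloring).** A randomized online edge-coloring algorithm on $n$ vertices is a probability distribution over deterministic online algorithms; the latter are given the vertex set $V$, $|V|=n$, and numbers $D(v)\in\mathbb{N}$ $(v\in V)$ in advance, then see the edges of a simple graph $G=(V,E)$ one at a time, and must irrevocably assign to each edge upon its arrival a color in $\mathbb{N}$, depending only on $(D(v))_{v\in V}$ and the edges that have arrived so far. The graph and the order of arrival are fixed by an oblivious adversary, i.e. before the algorithm's randomness is drawn. For $e=\{u,v\}\in E$ put $d_{\max}(e):=\max\{D(u),D(v)\}$. There exist a constant $c>0$ and, for every $n$, a randomized online edge-coloring algorithm such that for every simple graph $G=(V,E)$ with $n$ vertices, every arrival order of $E$, and all $D(v)$ with $D(v)\ge\deg_G(v)$ for every $v\in V$ (in particular when $D(v)=\deg_G(v)$, i.e. when the degree sequence is known in advance), the following holds with probability at least $1-n^{-c}$: the output $c: E\to\{1,2,\dots\}$ is a proper edge coloring of $G$, and every edge $e\in E$ satisfies $$c(e)\le d_{\max}(e)+2\cdot10^{24}\ln n+10^5\Bigl(d_{\max}(e)^{3/4}\ln^{1/2}d_{\max}(e)+d_{\max}(e)^{2/3}\ln^{1/3}n\Bigr).$$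 In particular, $c(e)\le(1+o(1))\,d_{\max}(e)$ when $d_{\max}(e)=\omega(\log n)$. That is, for every $g:\mathbb{N}\to\mathbb{R}$ with $g(n)/\ln n\to\infty$ there is $h:\mathbb{N}\to\mathbb{R}$ with $h(n)\to0$, such that, for the same algorithm and the same $G$, $D$ and arrival orders, with probability at least $1-n^{-c}$ the coloring is proper, all edges satisfy the bound above, and all edges $e$ with $d_{\max}(e)\ge g(n)$ satisfy $c(e)\le(1+h(n))\,d_{\max}(e)$. -/

import Mathlib

open Filter Topology MeasureTheory

/-- A randomized online edge-coloring algorithm for simple graphs on the vertex set `V`: a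
probability distribution over deterministic online algorithms. A random seed is drawn before the
input is revealed. On arrival of an edge, the algorithm irrevocably outputs its color, as a function
of the degree information `D` given in advance, the seed, the list of the edges that arrived
earlier (in chronological order), and the arriving edge. Nothing else about the graph is visible
to it. -/
structure OnlineEdgeColoringAlgorithm (V : Type) where
  Seed : Type
  [measurableSpace : MeasurableSpace Seed]
  law : Measure Seed
  [isProbabilityMeasure : IsProbabilityMeasure law]
  color : (D : V → ℕ) → Seed → (past : List (Sym2 V)) → (e : Sym2 V) → ℕ
  measurable_color : ∀ D past e, Measurable fun ω => color D ω past e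

attribute [instance] OnlineEdgeColoringAlgorithm.measurableSpace
  OnlineEdgeColoringAlgorithm.isProbabilityMeasure

/-- The color that edge `e` gets when the edges arrive in the order `es` and the random seed
is `ω`: the edges visible when `e` is colored are exactly those standing before `e` in `es`. -/
def OnlineEdgeColoringAlgorithm.output {V : Type} [DecidableEq V]
    (A : OnlineEdgeColoringAlgorithm V) (D : V → ℕ) (es : List (Sym2 V)) (ω : A.Seed)
    (e : Sym2 V) : ℕ :=
  A.color D ω (es.take (es.idxOf e)) e

/-- `es` lists every edge of `G` exactly once. -/
def SimpleGraph.IsArrivalOrder {V : Type} (G : SimpleGraph V) (es : List (Sym2 V)) : Prop :=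
  es.Nodup ∧ ∀ e, e ∈ es ↔ e ∈ G.edgeSet

/-- Distinct edges of `G` that share an endpoint get distinct colors. -/
def SimpleGraph.IsProperEdgeColoring {V : Type} (G : SimpleGraph V) (c : Sym2 V → ℕ) : Prop :=
  ∀ e ∈ G.edgeSet, ∀ f ∈ G.edgeSet, e ≠ f → (∃ v, v ∈ e ∧ v ∈ f) → c e ≠ c f

/-- `dMax D s(u, v) = max (D u) (D v)`. -/
def dMax {V : Type} (D : V → ℕ) (e : Sym2 V) : ℕ :=
  Sym2.lift ⟨fun u v => max (D u) (D v), fun u v => max_comm (D u) (D v)⟩ e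

/-- The bound on the color of an edge `e` of an `n`-vertex graph with `d_max(e) = d`. -/
noncomputable def localColorBound (n d : ℕ) : ℝ :=
  d + 2 * 10 ^ 24 * Real.log n +
    10 ^ 5 * ((d : ℝ) ^ (3 / 4 : ℝ) * (Real.log d) ^ (1 / 2 : ℝ) +
      (d : ℝ) ^ (2 / 3 : ℝ) * (Real.log n) ^ (1 / 3 : ℝ))

/-! The coloring proceeds in rounds. Each round extracts a matching from the edges that survived the
earlier rounds and gives it a color of its own. An edge with `d` nominal colors, `r` of which
remain, requests to be matched with probability `(1 - lam) / r`. If it is matched with probability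
at least `(1 - lam)` times its request, then `r` may be lowered by `1 - 2 * lam` per round, so that
the edge is nearly certain to be colored after about `d` rounds. The rates `lam` depend on the round
only; edges of small and large degree run side by side, and each is bounded by its own `d`.

A matching with these marginals is found online by giving each vertex a weight `X`, initially `1`.
An arriving edge `uv` is taken with probability `x * X u * X v`; taking it sets both weights to `0`,
not taking it divides them by the complementary probability. Until `uv` arrives, `X u * X v` is a
martingale, so the marginal would be exactly `x`. The loss comes from the cap `A` on the weights.
The reciprocal of `X u` decreases by at most `x * X b` per edge `ub`, so exceeding the cap needs a
large sum of such terms. An exponential supermartingale makes this unlikely (`pen_step`,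
`MatchParams.le_ex_matched`, `LevelParams.le_ex_matched`).

The total request at every vertex must stay below `1 - lam / 2`. A round removes at most one edge
per vertex, which acts like negative dependence: exponential moments of sums over surviving edges
are bounded as if the edges died independently (`LevelParams.ex_starProd_le`). A pessimistic
estimator combines these moments over all rounds and vertices (`Rates.ex_rounds_large_le`).

Few edges per vertex survive all rounds. The round colors skip enough integers below every index
that the survivors can be colored greedily with the skipped ones, still below the local bound
(`greedyColor_survivors`).

Each toss has a label formed from its round and edge. Hence the analysis may run round after round,
although the algorithm sends each edge through all rounds on arrival (`roundsTree_run_append`). -/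

/-- A finite randomized program: `flip j p s t` compares the seed with label `j` to the threshold
`p` and continues with `s` if the seed is smaller, and with `t` otherwise. -/
inductive CoinTree (ι α : Type) : Type
  | ret : α → CoinTree ι α
  | flip : ι → ℝ → CoinTree ι α → CoinTree ι α → CoinTree ι α

/-! ### Randomized programs with labelled tosses and their law -/

namespace CoinTree

variable {ι α β : Type}

/-- Sequential composition. -/
def bind (k : α → CoinTree ι β) : CoinTree ι α → CoinTree ι β
  | ret a => k a
  | flip j p s t => flip j p (bind k s) (bind k t)

open Classical in
/-- The result of a program on given seeds. -/
noncomputable def run (ω : ι → unitInterval) : CoinTree ι α → α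
  | ret a => a
  | flip j p s t => if (ω j : ℝ) < p then run ω s else run ω t

/-- The probability that a uniform seed is smaller than `p`. -/
noncomputable def clamp (p : ℝ) : ℝ := max 0 (min p 1)

/-- The expectation of `F` of the result, when all tosses are independent. -/
noncomputable def ex (F : α → ℝ) : CoinTree ι α → ℝ
  | ret a => F a
  | flip _ p s t => clamp p * ex F s + (1 - clamp p) * ex F t

/-- No path of positive probability uses a label twice, and all labels are in `S`. -/
def Fresh : Set ι → CoinTree ι α → Prop
  | _, ret _ => True
  | S, flip j p s t => j ∈ S ∧ (0 < p → Fresh (S \ {j}) s) ∧ Fresh (S \ {j}) t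

/-- All results satisfy `Q`. -/
def All (Q : α → Prop) : CoinTree ι α → Prop
  | ret a => Q a
  | flip _ p s t => (0 < p → All Q s) ∧ All Q t

theorem clamp_nonneg (p : ℝ) : 0 ≤ clamp p := le_max_left _ _

theorem clamp_le_one (p : ℝ) : clamp p ≤ 1 := max_le zero_le_one (min_le_right _ _)

theorem clamp_of_nonpos {p : ℝ} (h : p ≤ 0) : clamp p = 0 := by
  unfold clamp
  rw [max_eq_left]
  exact (min_le_left _ _).trans h

theorem clamp_of_mem {p : ℝ} (h0 : 0 ≤ p) (h1 : p ≤ 1) : clamp p = p := by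
  simp [clamp, min_eq_left h1, max_eq_right h0]

theorem run_bind (ω : ι → unitInterval) (k : α → CoinTree ι β) (p : CoinTree ι α) :
    run ω (bind k p) = run ω (k (run ω p)) := by
  induction p with
  | ret a => rfl
  | flip j p s t hs ht =>
    simp only [bind, run]
    split_ifs <;> assumption

theorem ex_bind (F : β → ℝ) (k : α → CoinTree ι β) (p : CoinTree ι α) :
    ex F (bind k p) = ex (fun a => ex F (k a)) p := by
  induction p with
  | ret a => rfl
  | flip j p s t hs ht => simp only [bind, ex, hs, ht]

theorem All.run {Q : α → Prop} {p : CoinTree ι α} (h : All Q p) (ω : ι → unitInterval) :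
    Q (p.run ω) := by
  induction p with
  | ret a => exact h
  | flip j p s t hs ht =>
    simp only [CoinTree.run]
    split_ifs with hp
    · exact hs (h.1 ((ω j).2.1.trans_lt hp))
    · exact ht h.2

theorem All.mono {Q R : α → Prop} (hQR : ∀ a, Q a → R a) {p : CoinTree ι α} (h : All Q p) :
    All R p := by
  induction p with
  | ret a => exact hQR _ h
  | flip j p s t hs ht => exact ⟨fun hp => hs (h.1 hp), ht h.2⟩

theorem All.bind {Q : α → Prop} {R : β → Prop} {k : α → CoinTree ι β} {p : CoinTree ι α}
    (h : All Q p) (hk : ∀ a, Q a → All R (k a)) : All R (CoinTree.bind k p) := by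
  induction p with
  | ret a => exact hk a h
  | flip j p s t hs ht => exact ⟨fun hp => hs (h.1 hp), ht h.2⟩

theorem all_true (p : CoinTree ι α) : All (fun _ => True) p := by
  induction p with
  | ret a => trivial
  | flip j p s t hs ht => exact ⟨fun _ => hs, ht⟩

theorem ex_le_ex {Q : α → Prop} {F G : α → ℝ} {p : CoinTree ι α} (h : All Q p)
    (hFG : ∀ a, Q a → F a ≤ G a) : ex F p ≤ ex G p := by
  induction p with
  | ret a => exact hFG a h
  | flip j p s t hs ht =>
    simp only [ex]
    have ht' := ht h.2
    have h1 := clamp_le_one p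
    rcases le_or_gt p 0 with hp | hp
    · simpa [clamp_of_nonpos hp] using ht'
    · have hs' := hs (h.1 hp)
      have h0 := clamp_nonneg p
      gcongr

theorem ex_mono {F G : α → ℝ} (p : CoinTree ι α) (hFG : ∀ a, F a ≤ G a) : ex F p ≤ ex G p :=
  ex_le_ex (all_true p) fun a _ => hFG a

theorem ex_const (c : ℝ) (p : CoinTree ι α) : ex (fun _ => c) p = c := by
  induction p with
  | ret a => rfl
  | flip j p s t hs ht => simp only [ex, hs, ht]; ring

theorem ex_add (F G : α → ℝ) (p : CoinTree ι α) :
    ex (fun a => F a + G a) p = ex F p + ex G p := by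
  induction p with
  | ret a => rfl
  | flip j p s t hs ht => simp only [ex, hs, ht]; ring

theorem ex_const_mul (c : ℝ) (F : α → ℝ) (p : CoinTree ι α) :
    ex (fun a => c * F a) p = c * ex F p := by
  induction p with
  | ret a => rfl
  | flip j p s t hs ht => simp only [ex, hs, ht]; ring

theorem ex_sum {κ : Type} (s : Finset κ) (F : κ → α → ℝ) (p : CoinTree ι α) :
    ex (fun a => ∑ i ∈ s, F i a) p = ∑ i ∈ s, ex (F i) p := by
  classical
  induction s using Finset.induction_on with
  | empty => simpa using ex_const 0 p
  | insert a s ha ih => simp only [Finset.sum_insert ha, ex_add, ih]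

theorem Fresh.mono {S T : Set ι} (hST : S ⊆ T) {p : CoinTree ι α} (h : Fresh S p) :
    Fresh T p := by
  induction p generalizing S T with
  | ret a => trivial
  | flip j p s t hs ht =>
    exact ⟨hST h.1, fun hp => hs (Set.sdiff_subset_sdiff_left hST) (h.2.1 hp),
      ht (Set.sdiff_subset_sdiff_left hST) h.2.2⟩

theorem Fresh.bind {S T : Set ι} (hST : Disjoint S T) {k : α → CoinTree ι β} {p : CoinTree ι α}
    {Q : α → Prop} (h : Fresh S p) (hQ : All Q p) (hk : ∀ a, Q a → Fresh T (k a)) :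
    Fresh (S ∪ T) (CoinTree.bind k p) := by
  induction p generalizing S with
  | ret a => exact (hk a hQ).mono Set.subset_union_right
  | flip j p s t hs ht =>
    have hd : Disjoint (S \ {j}) T := hST.mono_left Set.sdiff_subset
    have hsub : S \ {j} ∪ T ⊆ (S ∪ T) \ {j} := by
      rintro x (hx | hx)
      · exact ⟨Or.inl hx.1, hx.2⟩
      · refine ⟨Or.inr hx, fun hxj => ?_⟩
        rw [Set.mem_singleton_iff] at hxj
        exact Set.disjoint_left.1 hST h.1 (hxj ▸ hx)
    exact ⟨Or.inl h.1, fun hp => (hs hd (h.2.1 hp) (hQ.1 hp)).mono hsub,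
      (ht hd h.2.2 hQ.2).mono hsub⟩

theorem Fresh.run_update [DecidableEq ι] {S : Set ι} {p : CoinTree ι α} (h : Fresh S p) {j : ι}
    (hj : j ∉ S) (ω : ι → unitInterval) (u : unitInterval) :
    p.run (Function.update ω j u) = p.run ω := by
  induction p generalizing S with
  | ret a => rfl
  | flip i p s t hs ht =>
    have hij : i ≠ j := fun e => hj (e ▸ h.1)
    have hj' : j ∉ S \ {i} := fun e => hj e.1
    rcases le_or_gt p 0 with hp | hp
    · simp only [CoinTree.run, fun u : unitInterval => (hp.trans u.2.1).not_gt, if_false,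
        ht h.2.2 hj']
    · simp only [CoinTree.run, Function.update_of_ne hij, hs (h.2.1 hp) hj', ht h.2.2 hj']

theorem measurableSet_run (p : CoinTree ι α) (B : Set α) :
    MeasurableSet {ω : ι → unitInterval | p.run ω ∈ B} := by
  classical
  induction p with
  | ret a => exact MeasurableSet.const (a ∈ B)
  | flip j p s t hs ht =>
    have hj : MeasurableSet {ω : ι → unitInterval | (ω j : ℝ) < p} :=
      measurableSet_lt (by fun_prop) measurable_const
    have : {ω : ι → unitInterval | (flip j p s t).run ω ∈ B} =
        {ω | (ω j : ℝ) < p}.ite {ω | s.run ω ∈ B} {ω | t.run ω ∈ B} := by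
      ext ω
      by_cases h : (ω j : ℝ) < p <;> simp [run, Set.ite, h]
    rw [this]
    exact hj.ite hs ht

theorem measurable_run (p : CoinTree ι α) (f : α → ℕ) :
    Measurable fun ω : ι → unitInterval => f (p.run ω) :=
  fun B _ => measurableSet_run p (f ⁻¹' B)

theorem volume_lt_clamp (p : ℝ) :
    volume {u : unitInterval | (u : ℝ) < p} = ENNReal.ofReal (clamp p) := by
  rcases le_or_gt p 0 with h0 | h0
  · rw [clamp_of_nonpos h0]
    have : {u : unitInterval | (u : ℝ) < p} = ∅ := by
      ext u
      simpa using h0.trans u.2.1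
    simp [this]
  rcases le_or_gt p 1 with h1 | h1
  · rw [clamp_of_mem h0.le h1, ← unitInterval.volume_Iio ⟨p, h0.le, h1⟩]
    rfl
  · have : {u : unitInterval | (u : ℝ) < p} = Set.univ := by
      ext u
      simpa using u.2.2.trans_lt h1
    simp [this, clamp, min_eq_right h1.le]

/-- Independent uniform seeds. -/
noncomputable abbrev seedLaw (ι : Type) [Fintype ι] : Measure (ι → unitInterval) :=
  Measure.pi fun _ => volume

/-- Integrating out coordinate `j` first suffices, because `C` does not depend on it. -/
theorem seedLaw_inter_lt [Fintype ι] [DecidableEq ι] (j : ι) (p : ℝ)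
    {C : Set (ι → unitInterval)} (hC : MeasurableSet C)
    (hCj : ∀ ω u, Function.update ω j u ∈ C ↔ ω ∈ C) :
    seedLaw ι ({ω | (ω j : ℝ) < p} ∩ C) = ENNReal.ofReal (clamp p) * seedLaw ι C := by
  have hj : MeasurableSet {ω : ι → unitInterval | (ω j : ℝ) < p} :=
    measurableSet_lt (by fun_prop) measurable_const
  have hf : Measurable (({ω : ι → unitInterval | (ω j : ℝ) < p} ∩ C).indicator
      (fun _ => (1 : ENNReal))) := measurable_const.indicator (hj.inter hC)
  have hg : Measurable (C.indicator fun _ : ι → unitInterval => ENNReal.ofReal (clamp p)) :=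
    measurable_const.indicator hC
  have key := lintegral_eq_of_lmarginal_eq (μ := fun _ : ι => (volume : Measure unitInterval))
    {j} hf hg (by
      rw [lmarginal_singleton, lmarginal_singleton]
      funext ω
      by_cases hω : ω ∈ C
      · have h1 : ∀ u, Function.update ω j u ∈ C := fun u => (hCj ω u).2 hω
        have h2 : ∀ u : unitInterval, ({ω : ι → unitInterval | (ω j : ℝ) < p} ∩ C).indicator
            (fun _ => (1 : ENNReal)) (Function.update ω j u) =
            ({u : unitInterval | (u : ℝ) < p}).indicator (fun _ => 1) u := by
          intro u
          simp [Set.indicator, h1 u]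
        simp only [h2]
        rw [lintegral_indicator (measurableSet_lt (by fun_prop) measurable_const)]
        simp [Set.indicator, h1, volume_lt_clamp]
      · have h1 : ∀ u, Function.update ω j u ∉ C := fun u => mt (hCj ω u).1 hω
        simp [Set.indicator, h1])
  rw [lintegral_indicator (hj.inter hC), lintegral_indicator hC] at key
  simpa using key

/-- The seed at the root occurs in neither reachable subtree, so it is independent of their results,
and the recursion defining `ex` is the law of total probability. -/
theorem Fresh.seedLaw_run [Fintype ι] {S : Set ι} {p : CoinTree ι α} (h : Fresh S p)
    (B : Set α) :
    (seedLaw ι).real {ω | p.run ω ∈ B} = p.ex (B.indicator 1) := by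
  classical
  induction p generalizing S with
  | ret a =>
    by_cases ha : a ∈ B <;> simp [run, ex, ha]
  | flip j p s t hs ht =>
    -- Seeds are nonnegative, so for `p ≤ 0` the first branch never runs; `Fresh` says nothing about
    -- it.
    rcases le_or_gt p 0 with hp | hp
    · simp only [run, ex, fun u : unitInterval => (hp.trans u.2.1).not_gt, if_false,
        clamp_of_nonpos hp, ht h.2.2]
      ring
    have hj : MeasurableSet {ω : ι → unitInterval | (ω j : ℝ) < p} :=
      measurableSet_lt (by fun_prop) measurable_const
    have key : ∀ q : CoinTree ι α, Fresh (S \ {j}) q →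
        (seedLaw ι).real ({ω | (ω j : ℝ) < p} ∩ {ω | q.run ω ∈ B}) =
          clamp p * (seedLaw ι).real {ω | q.run ω ∈ B} := by
      intro q hq
      rw [Measure.real, seedLaw_inter_lt j p (measurableSet_run q B) (fun ω u => by
        simp only [Set.mem_ofPred_eq, hq.run_update (fun e => e.2 rfl)]), ENNReal.toReal_mul,
        ENNReal.toReal_ofReal (clamp_nonneg p), Measure.real]
    have e1 : {ω : ι → unitInterval | (flip j p s t).run ω ∈ B} ∩ {ω | (ω j : ℝ) < p} =
        {ω | (ω j : ℝ) < p} ∩ {ω | s.run ω ∈ B} := by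
      ext ω
      simp only [run, Set.mem_inter_iff, Set.mem_ofPred_eq]
      by_cases hω : (ω j : ℝ) < p <;> simp [hω]
    have e2 : {ω : ι → unitInterval | (flip j p s t).run ω ∈ B} \ {ω | (ω j : ℝ) < p} =
        {ω | t.run ω ∈ B} \ {ω | (ω j : ℝ) < p} := by
      ext ω
      simp only [run, Set.mem_sdiff, Set.mem_ofPred_eq]
      by_cases hω : (ω j : ℝ) < p <;> simp [hω]
    have h3 := measureReal_inter_add_sdiff (μ := seedLaw ι) (s := {ω | t.run ω ∈ B}) hj
    rw [← measureReal_inter_add_sdiff (μ := seedLaw ι) hj, e1, e2, key s (h.2.1 hp)]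
    rw [Set.inter_comm, key t h.2.2] at h3
    simp only [ex]
    rw [← hs (h.2.1 hp), ← ht h.2.2]
    linarith

end CoinTree

/-! ### The online matching algorithm and the one-step exponential inequality -/

section Matching

variable {V ι : Type}

/-- The product of `X` over the two endpoints of an edge. -/
def edgeProd (X : V → ℝ) (e : Sym2 V) : ℝ :=
  Sym2.lift ⟨fun a b => X a * X b, fun a b => mul_comm (X a) (X b)⟩ e

@[simp] theorem edgeProd_mk (X : V → ℝ) (a b : V) : edgeProd X s(a, b) = X a * X b := rfl

open Classical in
/-- The probability with which the online matching algorithm takes the arriving edge `e`, when the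
current vertex weights are `X`. -/
noncomputable def matchProb (A : ℝ) (x : Sym2 V → ℝ) (X : V → ℝ) (e : Sym2 V) : ℝ :=
  if ∀ v ∈ e, X v ≤ A then x e * edgeProd X e else 0

open Classical in
/-- The weights after `e` is matched. -/
noncomputable def killWeight (X : V → ℝ) (e : Sym2 V) : V → ℝ :=
  fun w => if w ∈ e then 0 else X w

open Classical in
/-- The weights after `e` is not matched although it had probability `p`. -/
noncomputable def scaleWeight (p : ℝ) (X : V → ℝ) (e : Sym2 V) : V → ℝ :=
  fun w => if w ∈ e then X w / (1 - p) else X w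

/-- The online matching algorithm with requests `x` and weight cap `A`; the result is the list of
the edges that are not matched. -/
noncomputable def matchTree (lab : Sym2 V → ι) (A : ℝ) (x : Sym2 V → ℝ) :
    (V → ℝ) → List (Sym2 V) → CoinTree ι (List (Sym2 V))
  | _, [] => .ret []
  | X, e :: l => .flip (lab e) (matchProb A x X e) (matchTree lab A x (killWeight X e) l)
      (.bind (fun S => .ret (e :: S))
        (matchTree lab A x (scaleWeight (matchProb A x X e) X e) l))

theorem edgeProd_eq_zero {X : V → ℝ} {e : Sym2 V} {v : V} (hv : v ∈ e) (hX : X v = 0) :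
    edgeProd X e = 0 := by
  obtain ⟨b, rfl⟩ := hv
  simp [hX]

theorem matchProb_eq_zero {A : ℝ} {x : Sym2 V → ℝ} {X : V → ℝ} {e : Sym2 V} {v : V} (hv : v ∈ e)
    (hX : X v = 0) : matchProb A x X e = 0 := by
  simp [matchProb, edgeProd_eq_zero hv hX]

/-- `S` arises from `l` by removing a matching. -/
def IsMatchedOut (l S : List (Sym2 V)) : Prop :=
  S.Sublist l ∧ ∀ v, ∀ e ∈ l, ∀ f ∈ l, v ∈ e → v ∈ f → e ∉ S → f ∉ S → e = f

/-- The second conjunct carries the induction: matched vertices get weight `0`, both updates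
preserve weight `0`, and an edge at such a vertex has probability `0`. -/
theorem matchTree_all_aux (lab : Sym2 V → ι) (A : ℝ) (x : Sym2 V → ℝ) (X : V → ℝ)
    (l : List (Sym2 V)) :
    (matchTree lab A x X l).All fun S =>
      IsMatchedOut l S ∧ ∀ v, X v = 0 → ∀ e ∈ l, v ∈ e → e ∈ S := by
  induction l generalizing X with
  | nil => exact ⟨⟨List.Sublist.refl _, by simp⟩, by simp⟩
  | cons e l ih =>
    refine ⟨fun hp => ?_, ?_⟩
    · refine (ih (killWeight X e)).mono fun S hS => ⟨⟨hS.1.1.cons e, ?_⟩, ?_⟩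
      · have key : ∀ v, v ∈ e → ∀ f ∈ e :: l, v ∈ f → f ∉ S → f = e := by
          intro v hve f hf hvf hfS
          rcases List.mem_cons.1 hf with rfl | hf
          · rfl
          · exact absurd (hS.2 v (by simp [killWeight, hve]) f hf hvf) hfS
        intro v a ha b hb hva hvb haS hbS
        by_cases hve : v ∈ e
        · rw [key v hve a ha hva haS, key v hve b hb hvb hbS]
        · have hal : a ∈ l := (List.mem_cons.1 ha).resolve_left (fun h => hve (h ▸ hva))
          have hbl : b ∈ l := (List.mem_cons.1 hb).resolve_left (fun h => hve (h ▸ hvb))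
          exact hS.1.2 v a hal b hbl hva hvb haS hbS
      · intro v hv f hf hvf
        rcases List.mem_cons.1 hf with rfl | hf
        · rw [matchProb_eq_zero hvf hv] at hp
          exact absurd hp (lt_irrefl 0)
        · exact hS.2 v (by simp [killWeight, hv]) f hf hvf
    · refine (ih (scaleWeight _ X e)).bind fun S hS => ⟨⟨hS.1.1.cons_cons e, ?_⟩, ?_⟩
      · intro v a ha b hb hva hvb haS hbS
        rw [List.mem_cons, not_or] at haS hbS
        exact hS.1.2 v a ((List.mem_cons.1 ha).resolve_left haS.1) b
          ((List.mem_cons.1 hb).resolve_left hbS.1) hva hvb haS.2 hbS.2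
      · intro v hv f hf hvf
        rcases List.mem_cons.1 hf with rfl | hf
        · exact List.mem_cons_self
        · exact List.mem_cons_of_mem _ (hS.2 v (by simp [scaleWeight, hv]) f hf hvf)

theorem matchTree_all (lab : Sym2 V → ι) (A : ℝ) (x : Sym2 V → ℝ) (X : V → ℝ)
    (l : List (Sym2 V)) : (matchTree lab A x X l).All (IsMatchedOut l) :=
  (matchTree_all_aux lab A x X l).mono fun _ h => h.1

theorem matchTree_fresh {lab : Sym2 V → ι} (hlab : Function.Injective lab) (A : ℝ)
    (x : Sym2 V → ℝ) (X : V → ℝ) {l : List (Sym2 V)} (hl : l.Nodup) :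
    (matchTree lab A x X l).Fresh (lab '' {e | e ∈ l}) := by
  induction l generalizing X with
  | nil => trivial
  | cons e l ih =>
    have hsub : lab '' {f | f ∈ l} ⊆ lab '' {f | f ∈ e :: l} \ {lab e} := by
      rintro _ ⟨f, hf, rfl⟩
      refine ⟨⟨f, List.mem_cons_of_mem _ hf, rfl⟩, fun h => ?_⟩
      exact (List.nodup_cons.1 hl).1 (hlab h ▸ hf)
    refine ⟨⟨e, List.mem_cons_self, rfl⟩, fun _ => (ih _ (List.nodup_cons.1 hl).2).mono hsub, ?_⟩
    have := (ih (scaleWeight (matchProb A x X e) X e) (List.nodup_cons.1 hl).2).bind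
      (T := ∅) (k := fun S => .ret (e :: S)) (Set.disjoint_empty _) (CoinTree.all_true _)
      (fun _ _ => trivial)
    rw [Set.union_empty] at this
    exact this.mono hsub

/-- The contribution of a neighbour of weight `X` over an edge with request `y` to the exponent of
the potential of a vertex. -/
def pen (θ B y X : ℝ) : ℝ := θ * y * X + 5 * θ ^ 2 * y ^ 2 * (2 * B * X - X ^ 2)

theorem pen_zero (θ B X : ℝ) : pen θ B 0 X = 0 := by simp [pen]

theorem exp_le_one_add_sq {z : ℝ} (hz : |z| ≤ 1) : Real.exp z ≤ 1 + z + z ^ 2 := by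
  have := (abs_le.1 (Real.abs_exp_sub_one_sub_id_le hz)).2
  linarith

theorem mul_le_pen {θ B y X : ℝ} (hX0 : 0 ≤ X) (hXB : X ≤ B) : θ * y * X ≤ pen θ B y X := by
  have : 0 ≤ 2 * B * X - X ^ 2 := by nlinarith
  have : 0 ≤ 5 * θ ^ 2 * y ^ 2 * (2 * B * X - X ^ 2) := by positivity
  unfold pen
  linarith

theorem pen_nonneg {θ B y X : ℝ} (hθ : 0 ≤ θ) (hy : 0 ≤ y) (hX0 : 0 ≤ X) (hXB : X ≤ B) :
    0 ≤ pen θ B y X :=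
  le_trans (by positivity) (mul_le_pen hX0 hXB)

/-- The quadratic correction is at most `10 * (θ * y * B) * (θ * y * X)`, a tenth of the linear
term. -/
theorem pen_le {θ B y X : ℝ} (hθ : 0 ≤ θ) (hy : 0 ≤ y) (hB : θ * y * B ≤ 1 / 100) (hX0 : 0 ≤ X) :
    pen θ B y X ≤ 1.1 * (θ * y * X) := by
  have h1 : 0 ≤ θ * y * X := by positivity
  have h2 := mul_le_mul_of_nonneg_left hB h1
  have h3 : 0 ≤ θ ^ 2 * y ^ 2 * X ^ 2 := by positivity
  unfold pen
  nlinarith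

/-- Scaling the weight from `X` to `X / (1 - P)`: first-order gain. -/
theorem pen_scale {θ B y X P : ℝ} (hP1 : P ≤ 1 / 2) :
    (1 - P) * (pen θ B y (X / (1 - P)) - pen θ B y X) =
      P * pen θ B y X - 5 * θ ^ 2 * y ^ 2 * X ^ 2 * (P / (1 - P)) := by
  have : (1 - P) ≠ 0 := by linarith
  unfold pen
  field_simp
  ring

/-- To first order the linear part of `pen` is a martingale, while its concave part `2 * B * X - X ^
2` has negative drift. That drift pays for the second-order terms of `exp z ≤ 1 + z + z ^ 2`. -/
theorem pen_step {θ B y z X Y P : ℝ} (hθ : 0 ≤ θ) (hy : 0 ≤ y) (hz : 0 ≤ z)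
    (hyB : θ * y * B ≤ 1 / 100) (hzB : θ * z * B ≤ 1 / 100) (hP0 : 0 ≤ P) (hP1 : P ≤ 1 / 2)
    (hX0 : 0 ≤ X) (hY0 : 0 ≤ Y) (hXB : X / (1 - P) ≤ B) (hYB : Y / (1 - P) ≤ B) :
    P * Real.exp (-(pen θ B y X + pen θ B z Y)) +
      (1 - P) * Real.exp (pen θ B y (X / (1 - P)) - pen θ B y X +
        (pen θ B z (Y / (1 - P)) - pen θ B z Y)) ≤ 1 := by
  have hP : 0 < 1 - P := by linarith
  have aux : ∀ {y X : ℝ}, 0 ≤ y → θ * y * B ≤ 1 / 100 → 0 ≤ X → X / (1 - P) ≤ B →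
      0 ≤ pen θ B y X ∧ pen θ B y X ≤ 1.1 * (θ * y * X) ∧ θ * y * X ≤ 1 / 100 ∧
      0 ≤ pen θ B y (X / (1 - P)) - pen θ B y X ∧
      (1 - P) * (pen θ B y (X / (1 - P)) - pen θ B y X) ≤
        P * pen θ B y X - 5 * (θ * y * X) ^ 2 * P ∧
      (1 - P) * (pen θ B y (X / (1 - P)) - pen θ B y X) ≤ P * (1.1 * (θ * y * X)) := by
    intro y X hy hyB hX0 hXB
    have hXX : X ≤ X / (1 - P) := by
      rw [le_div_iff₀ hP]; nlinarith
    have hXB' : X ≤ B := hXX.trans hXB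
    have h1 := pen_nonneg (B := B) hθ hy hX0 hXB'
    have h2 := pen_le hθ hy hyB hX0
    have h3 : θ * y * X ≤ 1 / 100 :=
      (mul_le_mul_of_nonneg_left hXB' (by positivity)).trans hyB
    have h4 : 0 ≤ pen θ B y (X / (1 - P)) - pen θ B y X := by
      have e : pen θ B y (X / (1 - P)) - pen θ B y X = (X / (1 - P) - X) *
          (θ * y + 5 * θ ^ 2 * y ^ 2 * ((B - X / (1 - P)) + (B - X))) := by unfold pen; ring
      rw [e]
      have a1 : 0 ≤ X / (1 - P) - X := by linarith
      have a2 : 0 ≤ (B - X / (1 - P)) + (B - X) := by linarith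
      positivity
    have h5 := pen_scale (θ := θ) (B := B) (y := y) (X := X) hP1
    have h6 : P ≤ P / (1 - P) := by rw [le_div_iff₀ hP]; nlinarith
    have h7 : 5 * (θ * y * X) ^ 2 * P ≤ 5 * θ ^ 2 * y ^ 2 * X ^ 2 * (P / (1 - P)) := by
      have : 0 ≤ 5 * θ ^ 2 * y ^ 2 * X ^ 2 := by positivity
      nlinarith
    refine ⟨h1, h2, h3, h4, by linarith, ?_⟩
    have h8 : 0 ≤ 5 * (θ * y * X) ^ 2 * P := by positivity
    nlinarith
  obtain ⟨a1, a2, a3, a4, a5, a6⟩ := aux hy hyB hX0 hXB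
  obtain ⟨b1, b2, b3, b4, b5, b6⟩ := aux hz hzB hY0 hYB
  set g := pen θ B y X
  set h := pen θ B z Y
  set c := pen θ B y (X / (1 - P)) - g
  set d := pen θ B z (Y / (1 - P)) - h
  set s := θ * y * X
  set t := θ * z * Y
  have hs : 0 ≤ s := by positivity
  have ht : 0 ≤ t := by positivity
  have k1 : Real.exp (-(g + h)) ≤ 1 + -(g + h) + (-(g + h)) ^ 2 :=
    exp_le_one_add_sq (by rw [abs_neg, abs_of_nonneg] <;> linarith)
  have hcd : (1 - P) * (c + d) ≤ P * (1.1 * (s + t)) := by linarith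
  have hcd' : c + d ≤ 1.1 * (s + t) := by
    have : P * (1.1 * (s + t)) ≤ (1 - P) * (1.1 * (s + t)) := by
      apply mul_le_mul_of_nonneg_right <;> linarith
    exact le_of_mul_le_mul_left (hcd.trans this) hP
  have k2 : Real.exp (c + d) ≤ 1 + (c + d) + (c + d) ^ 2 :=
    exp_le_one_add_sq (by rw [abs_of_nonneg] <;> linarith)
  have k3 : P * (g + h) ^ 2 ≤ P * (1.1 * (s + t)) ^ 2 := by
    apply mul_le_mul_of_nonneg_left _ hP0
    apply pow_le_pow_left₀ <;> linarith
  have k4 : (1 - P) * (c + d) ^ 2 ≤ P * (1.1 * (s + t)) ^ 2 := by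
    have : (1 - P) * (c + d) * (c + d) ≤ P * (1.1 * (s + t)) * (1.1 * (s + t)) := by
      apply mul_le_mul hcd hcd' <;> [linarith; positivity]
    linarith
  -- Both branches contribute a quadratic error of this size; together they use up exactly the drift
  -- `5 * (s ^ 2 + t ^ 2) * P` from `a5` and `b5`.
  have k5 : P * (1.1 * (s + t)) ^ 2 ≤ P * (2.5 * (s ^ 2 + t ^ 2)) := by
    apply mul_le_mul_of_nonneg_left _ hP0
    nlinarith [sq_nonneg (s - t)]
  have k6 := mul_le_mul_of_nonneg_left k1 hP0
  have k7 := mul_le_mul_of_nonneg_left k2 hP.le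
  linarith

end Matching

/-! ### Weights rarely exceed the cap: lower bound on the matching probability -/

section Marginal

variable {V ι : Type}

open Classical in
/-- The value of `x` on the edge `uw` if that edge is in `l`, and `0` otherwise. -/
noncomputable def starWeight (x : Sym2 V → ℝ) (l : List (Sym2 V)) (u w : V) : ℝ :=
  if s(u, w) ∈ l then x s(u, w) else 0

theorem starWeight_nonneg {x : Sym2 V → ℝ} (hx : ∀ e, 0 ≤ x e) (l : List (Sym2 V)) (u w : V) :
    0 ≤ starWeight x l u w := by
  unfold starWeight
  split_ifs
  exacts [hx _, le_rfl]

theorem starWeight_le {x : Sym2 V → ℝ} {r : ℝ} (hx : ∀ e, x e ≤ r) (hr : 0 ≤ r)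
    (l : List (Sym2 V)) (u w : V) : starWeight x l u w ≤ r := by
  unfold starWeight
  split_ifs
  exacts [hx _, hr]

theorem starWeight_cons_of_ne {x : Sym2 V → ℝ} {l : List (Sym2 V)} {e : Sym2 V} {u w : V}
    (h : s(u, w) ≠ e) : starWeight x (e :: l) u w = starWeight x l u w := by
  have : s(u, w) ∈ e :: l ↔ s(u, w) ∈ l := by
    rw [List.mem_cons, or_iff_right h]
  unfold starWeight
  by_cases hm : s(u, w) ∈ l
  · rw [if_pos hm, if_pos (this.2 hm)]
  · rw [if_neg hm, if_neg (mt this.1 hm)]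

/-- The parameters of the matching algorithm are compatible. -/
structure MatchParams (A θ r : ℝ) (x : Sym2 V → ℝ) : Prop where
  one_le : 1 ≤ A
  theta_nonneg : 0 ≤ θ
  x_nonneg : ∀ e, 0 ≤ x e
  x_le : ∀ e, x e ≤ r
  r_nonneg : 0 ≤ r
  sq_le : r * A ^ 2 ≤ 1 / 2
  theta_le : θ * r * (2 * A) ≤ 1 / 100

variable {A θ r : ℝ} {x : Sym2 V → ℝ}

theorem MatchParams.matchProb_mem (h : MatchParams A θ r x) {X : V → ℝ} (hX : ∀ w, 0 ≤ X w)
    (e : Sym2 V) : 0 ≤ matchProb A x X e ∧ matchProb A x X e ≤ 1 / 2 := by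
  induction e using Sym2.ind with
  | _ a b =>
    unfold matchProb
    split_ifs with hc
    · have ha := hc a (by simp)
      have hb := hc b (by simp)
      refine ⟨mul_nonneg (h.x_nonneg _) (mul_nonneg (hX a) (hX b)), le_trans ?_ h.sq_le⟩
      rw [edgeProd_mk, sq]
      have hA := h.one_le
      gcongr
      exacts [mul_nonneg (hX a) (hX b), h.r_nonneg, h.x_le _, hX b]
    · norm_num

/-- A weight above `A` is no longer scaled, since its edges have probability `0`. A weight below `A`
at most doubles, since probabilities are at most `1 / 2`. -/
theorem MatchParams.scaleWeight_mem (h : MatchParams A θ r x) {X : V → ℝ} (hX : ∀ w, 0 ≤ X w)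
    (hXB : ∀ w, X w ≤ 2 * A) (e : Sym2 V) (w : V) :
    0 ≤ scaleWeight (matchProb A x X e) X e w ∧
      scaleWeight (matchProb A x X e) X e w ≤ 2 * A := by
  have hp := h.matchProb_mem hX e
  unfold scaleWeight
  split_ifs with hw
  · refine ⟨div_nonneg (hX w) (by linarith), ?_⟩
    rw [div_le_iff₀ (by linarith)]
    by_cases hc : ∀ v ∈ e, X v ≤ A
    · have := hc w hw
      have := h.one_le
      nlinarith
    · rw [matchProb, if_neg hc]
      simpa using hXB w
  · exact ⟨hX w, hXB w⟩

theorem killWeight_mem {X : V → ℝ} {B : ℝ} (hX : ∀ w, 0 ≤ X w) (hXB : ∀ w, X w ≤ B)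
    (e : Sym2 V) (w : V) : 0 ≤ killWeight X e w ∧ killWeight X e w ≤ B := by
  unfold killWeight
  split_ifs
  exacts [⟨le_rfl, (hX w).trans (hXB w)⟩, ⟨hX w, hXB w⟩]

theorem MatchParams.pen_nonneg (h : MatchParams A θ r x) {X : V → ℝ} (hX : ∀ w, 0 ≤ X w)
    (hXB : ∀ w, X w ≤ 2 * A) (l : List (Sym2 V)) (u w : V) :
    0 ≤ pen θ (2 * A) (starWeight x l u w) (X w) :=
  _root_.pen_nonneg h.theta_nonneg (starWeight_nonneg h.x_nonneg l u w) (hX w) (hXB w)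

variable [Fintype V]

/-- The potential whose growth bounds the probability that the weight of `u` exceeds the cap. -/
noncomputable def starPotential (θ B : ℝ) (x : Sym2 V → ℝ) (u : V) (s : ℝ) (X : V → ℝ)
    (l : List (Sym2 V)) : ℝ :=
  Real.exp (θ * s + ∑ w, pen θ B (starWeight x l u w) (X w))

theorem starPotential_pos (θ B : ℝ) (x : Sym2 V → ℝ) (u : V) (s : ℝ) (X : V → ℝ)
    (l : List (Sym2 V)) : 0 < starPotential θ B x u s X l := Real.exp_pos _

theorem MatchParams.starPotential_step_of_notMem (h : MatchParams A θ r x) {X : V → ℝ}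
    (hX : ∀ w, 0 ≤ X w) (hXB : ∀ w, X w ≤ 2 * A) {e : Sym2 V} (he : ¬ e.IsDiag)
    (l : List (Sym2 V)) {u : V} (hu : u ∉ e) (s : ℝ) :
    matchProb A x X e * starPotential θ (2 * A) x u s (killWeight X e) l +
      (1 - matchProb A x X e) *
        starPotential θ (2 * A) x u s (scaleWeight (matchProb A x X e) X e) l ≤
      starPotential θ (2 * A) x u s X (e :: l) := by
  have hp := h.matchProb_mem hX e
  have hsc := h.scaleWeight_mem hX hXB e
  set p := matchProb A x X e
  have hne : ∀ w, s(u, w) ≠ e := fun w hw => hu (hw ▸ Sym2.mem_mk_left u w)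
  unfold starPotential
  simp only [fun w => starWeight_cons_of_ne (x := x) (l := l) (hne w)]
  clear_value p
  induction e using Sym2.ind with
  | _ a b =>
    have hab : a ≠ b := fun hh => he (by simp [hh])
    set y := starWeight x l u
    have hy : ∀ w, 0 ≤ y w := starWeight_nonneg h.x_nonneg l u
    have hyB : ∀ w, θ * y w * (2 * A) ≤ 1 / 100 := fun w => by
      refine le_trans ?_ h.theta_le
      have := h.theta_nonneg
      have := h.one_le
      have := starWeight_le h.x_le h.r_nonneg l u w
      gcongr
    have diff : ∀ X' : V → ℝ, (∀ w, w ≠ a ∧ w ≠ b → X' w = X w) →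
        θ * s + ∑ w, pen θ (2 * A) (y w) (X' w) =
        (θ * s + ∑ w, pen θ (2 * A) (y w) (X w)) +
          ((pen θ (2 * A) (y a) (X' a) - pen θ (2 * A) (y a) (X a)) +
          (pen θ (2 * A) (y b) (X' b) - pen θ (2 * A) (y b) (X b))) := by
      intro X' hX'
      have := Fintype.sum_eq_add (f := fun w => pen θ (2 * A) (y w) (X' w) -
        pen θ (2 * A) (y w) (X w)) a b hab (fun w hw => by rw [hX' w hw, sub_self])
      rw [Finset.sum_sub_distrib] at this
      linarith
    have k0 : ∀ w, w ≠ a ∧ w ≠ b → killWeight X s(a, b) w = X w := by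
      intro w hw
      simp [killWeight, hw.1, hw.2]
    have k1 : ∀ w, w ≠ a ∧ w ≠ b → scaleWeight p X s(a, b) w = X w := by
      intro w hw
      simp [scaleWeight, hw.1, hw.2]
    rw [diff _ k0, diff _ k1, Real.exp_add, Real.exp_add (θ * s + _)]
    have ea : killWeight X s(a, b) a = 0 := by simp [killWeight]
    have eb : killWeight X s(a, b) b = 0 := by simp [killWeight]
    have ca : scaleWeight p X s(a, b) a = X a / (1 - p) := by simp [scaleWeight]
    have cb : scaleWeight p X s(a, b) b = X b / (1 - p) := by simp [scaleWeight]
    have step := pen_step h.theta_nonneg (hy a) (hy b) (hyB a) (hyB b) hp.1 hp.2 (hX a) (hX b)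
      (ca ▸ (hsc a).2) (cb ▸ (hsc b).2)
    have z0 : ∀ w, pen θ (2 * A) (y w) 0 = 0 := fun w => by simp [pen]
    rw [ea, eb, ca, cb, z0, z0]
    have e1 : (0 - pen θ (2 * A) (y a) (X a) + (0 - pen θ (2 * A) (y b) (X b))) =
      -(pen θ (2 * A) (y a) (X a) + pen θ (2 * A) (y b) (X b)) := by ring
    rw [e1]
    have := mul_le_mul_of_nonneg_left step
      (Real.exp_pos (θ * s + ∑ w, pen θ (2 * A) (y w) (X w))).le
    linarith

/-- When the edge `ub` is processed, its `pen` term leaves the sum and at least its linear part `θ *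
x * X b` is available for the increase of `s`. The weight of `u` itself never enters, as there are
no loops. -/
theorem starPotential_step_of_mem {X : V → ℝ}
    (hX : ∀ w, 0 ≤ X w) (hXB : ∀ w, X w ≤ 2 * A) {u b : V} (hub : u ≠ b) {l : List (Sym2 V)}
    (hl : ∀ e ∈ l, ¬ e.IsDiag) (hbl : s(u, b) ∉ l) (s : ℝ) {X' : V → ℝ}
    (hX' : ∀ w, w ≠ u ∧ w ≠ b → X' w = X w) :
    starPotential θ (2 * A) x u (s + x s(u, b) * X b) X' l ≤
      starPotential θ (2 * A) x u s X (s(u, b) :: l) := by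
  unfold starPotential
  rw [Real.exp_le_exp]
  have hu0 : ∀ l : List (Sym2 V), (∀ e ∈ l, ¬ e.IsDiag) → starWeight x l u u = 0 := by
    intro l hl
    rw [starWeight, if_neg]
    intro hm
    exact hl _ hm (by simp)
  have hcons : ∀ e ∈ s(u, b) :: l, ¬ e.IsDiag := by
    intro e he
    rcases List.mem_cons.1 he with rfl | he
    · simpa using hub
    · exact hl e he
  have key := Fintype.sum_eq_single (f := fun w =>
      pen θ (2 * A) (starWeight x (s(u, b) :: l) u w) (X w) -
        pen θ (2 * A) (starWeight x l u w) (X' w)) b (fun w hw => by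
    by_cases hwu : w = u
    · subst hwu
      rw [hu0 _ hl, hu0 _ hcons, pen_zero, pen_zero, sub_self]
    · rw [hX' w ⟨hwu, hw⟩, starWeight_cons_of_ne (by simp [hw, hwu]), sub_self])
  have e1 : starWeight x (s(u, b) :: l) u b = x s(u, b) := by simp [starWeight]
  have e2 : starWeight x l u b = 0 := by simp [starWeight, hbl]
  rw [Finset.sum_sub_distrib, e1, e2, pen_zero, sub_zero] at key
  have := mul_le_pen (θ := θ) (y := x s(u, b)) (hX b) (hXB b)
  linarith

/-- The potential can be continued over the next edge so that it does not grow in expectation and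
keeps controlling the weight of `u`. -/
theorem MatchParams.starPotential_step (h : MatchParams A θ r x) {X : V → ℝ}
    (hX : ∀ w, 0 ≤ X w) (hXB : ∀ w, X w ≤ 2 * A) {e : Sym2 V} {l : List (Sym2 V)}
    (hd : ∀ f ∈ e :: l, ¬ f.IsDiag) (hn : (e :: l).Nodup) (u : V) {s : ℝ}
    (hs : X u * (1 - s) ≤ 1) :
    ∃ s', killWeight X e u * (1 - s') ≤ 1 ∧
      scaleWeight (matchProb A x X e) X e u * (1 - s') ≤ 1 ∧
      matchProb A x X e * starPotential θ (2 * A) x u s' (killWeight X e) l +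
        (1 - matchProb A x X e) *
          starPotential θ (2 * A) x u s' (scaleWeight (matchProb A x X e) X e) l ≤
        starPotential θ (2 * A) x u s X (e :: l) := by
  by_cases hu : u ∈ e
  · obtain ⟨b, rfl⟩ := hu
    have hub : u ≠ b := by simpa using hd _ List.mem_cons_self
    have hp := h.matchProb_mem hX s(u, b)
    set p := matchProb A x X s(u, b) with hpdef
    have hd' : ∀ f ∈ l, ¬ f.IsDiag := fun f hf => hd f (List.mem_cons_of_mem _ hf)
    have h1 := starPotential_step_of_mem (θ := θ) (x := x) hX hXB hub hd' (List.nodup_cons.1 hn).1 s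
      (X' := killWeight X s(u, b)) (fun w hw => by simp [killWeight, hw.1, hw.2])
    have h2 := starPotential_step_of_mem (θ := θ) (x := x) hX hXB hub hd' (List.nodup_cons.1 hn).1 s
      (X' := scaleWeight p X s(u, b)) (fun w hw => by simp [scaleWeight, hw.1, hw.2])
    -- The reciprocal of `X u` falls by `p / X u ≤ x * X b` when the edge is not taken, so adding
    -- this amount to `s` keeps `X u * (1 - s) ≤ 1`.
    refine ⟨s + x s(u, b) * X b, by simp [killWeight], ?_, ?_⟩
    · have e1 : scaleWeight p X s(u, b) u = X u / (1 - p) := by simp [scaleWeight]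
      rw [e1, div_mul_eq_mul_div, div_le_one (by linarith)]
      have hxX : 0 ≤ x s(u, b) * (X u * X b) :=
        mul_nonneg (h.x_nonneg _) (mul_nonneg (hX u) (hX b))
      have hple : p ≤ x s(u, b) * (X u * X b) := by
        rw [hpdef, matchProb]
        split_ifs
        · rw [edgeProd_mk]
        · exact hxX
      nlinarith
    · have h3 := mul_le_mul_of_nonneg_left h1 hp.1
      have h4 := mul_le_mul_of_nonneg_left h2 (show 0 ≤ 1 - p by linarith)
      linarith
  · refine ⟨s, by simpa [killWeight, hu] using hs, by simpa [scaleWeight, hu] using hs,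
      h.starPotential_step_of_notMem hX hXB (hd e List.mem_cons_self) l hu s⟩

/-- If `X u > A`, the invariant `X u * (1 - s) ≤ 1` forces `s ≥ 1 - 1 / A`, and the `pen` terms are
nonnegative. -/
theorem MatchParams.le_starPotential (h : MatchParams A θ r x) {X : V → ℝ}
    (hX : ∀ w, 0 ≤ X w) (hXB : ∀ w, X w ≤ 2 * A) (l : List (Sym2 V)) {u : V} {s : ℝ}
    (hs : X u * (1 - s) ≤ 1) (hu : A < X u) :
    Real.exp (θ * (1 - 1 / A)) ≤ starPotential θ (2 * A) x u s X l := by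
  unfold starPotential
  rw [Real.exp_le_exp]
  have hA := h.one_le
  have h1 : 1 - 1 / A ≤ s := by
    have : (1 - s) * A ≤ 1 := by
      rcases le_or_gt (1 - s) 0 with h0 | h0
      · nlinarith
      · nlinarith
    rw [← le_div_iff₀ (by linarith)] at this
    linarith
  have h2 := Finset.sum_nonneg fun w (_ : w ∈ Finset.univ) => h.pen_nonneg hX hXB l u w
  have := mul_le_mul_of_nonneg_left h1 h.theta_nonneg
  linarith

-- Up to the arrival of `uv`, the product `X u * X v` is a martingale and the two potentials are
-- supermartingales, so the left side is a submartingale. On arrival it is at most the probability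
-- of taking the edge.
open Classical in
theorem MatchParams.le_ex_matched (h : MatchParams A θ r x) (lab : Sym2 V → ι) {u v : V}
    {l : List (Sym2 V)} {X : V → ℝ} (hX : ∀ w, 0 ≤ X w) (hXB : ∀ w, X w ≤ 2 * A)
    (hd : ∀ f ∈ l, ¬ f.IsDiag) (hn : l.Nodup) (huv : s(u, v) ∈ l) {s t : ℝ}
    (hs : X u * (1 - s) ≤ 1) (ht : X v * (1 - t) ≤ 1) {C : ℝ} (hC : 0 ≤ C)
    (hCA : (2 * A) ^ 2 ≤ C * Real.exp (θ * (1 - 1 / A))) :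
    x s(u, v) * (X u * X v - C * starPotential θ (2 * A) x u s X l -
        C * starPotential θ (2 * A) x v t X l) ≤
      (matchTree lab A x X l).ex fun S => if s(u, v) ∈ S then 0 else 1 := by
  induction l generalizing X s t with
  | nil => simp at huv
  | cons e l ih =>
    have hp := h.matchProb_mem hX e
    have hx := h.x_nonneg s(u, v)
    have hUV : X u * X v ≤ (2 * A) ^ 2 := by
      rw [sq]
      exact mul_le_mul (hXB u) (hXB v) (hX v) ((hX u).trans (hXB u))
    have hU := mul_nonneg hC (starPotential_pos θ (2 * A) x u s X (e :: l)).le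
    have hV := mul_nonneg hC (starPotential_pos θ (2 * A) x v t X (e :: l)).le
    simp only [matchTree, CoinTree.ex, CoinTree.ex_bind,
      CoinTree.clamp_of_mem hp.1 (hp.2.trans (by norm_num))]
    by_cases he : e = s(u, v)
    · subst he
      have hul : s(u, v) ∉ l := (List.nodup_cons.1 hn).1
      have e1 : (matchTree lab A x (killWeight X s(u, v)) l).ex
          (fun S => if s(u, v) ∈ S then (0 : ℝ) else 1) = 1 := by
        refine le_antisymm ?_ ?_
        · refine (CoinTree.ex_mono _ fun S => ?_).trans_eq (CoinTree.ex_const 1 _)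
          split_ifs <;> norm_num
        · refine (CoinTree.ex_const 1 _).symm.trans_le
            (CoinTree.ex_le_ex (matchTree_all lab A x _ l) fun S hS => ?_)
          rw [if_neg fun hm => hul (hS.1.subset hm)]
      have e2 : (fun S : List (Sym2 V) =>
          if s(u, v) ∈ s(u, v) :: S then (0 : ℝ) else 1) = fun _ => 0 := by
        funext S; simp
      rw [e1, e2, CoinTree.ex_const, mul_zero, add_zero, mul_one]
      by_cases hc : ∀ w ∈ s(u, v), X w ≤ A
      · rw [matchProb, if_pos hc, edgeProd_mk]
        apply mul_le_mul_of_nonneg_left _ hx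
        linarith
      -- Above the cap the edge is refused, but then one potential term alone is at least `(2 * A) ^
      -- 2 ≥ X u * X v`, and the left side is not positive.
      · rw [matchProb, if_neg hc]
        apply mul_nonpos_of_nonneg_of_nonpos hx
        push Not at hc
        obtain ⟨w, hw, hwA⟩ := hc
        rcases Sym2.mem_iff.1 hw with rfl | rfl
        · have := mul_le_mul_of_nonneg_left (h.le_starPotential hX hXB (s(w, v) :: l) hs hwA) hC
          linarith
        · have := mul_le_mul_of_nonneg_left (h.le_starPotential hX hXB (s(u, w) :: l) ht hwA) hC
          linarith
    · have huvl : s(u, v) ∈ l := (List.mem_cons.1 huv).resolve_left (Ne.symm he)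
      have e2 : (fun S : List (Sym2 V) => if s(u, v) ∈ e :: S then (0 : ℝ) else 1) =
          fun S => if s(u, v) ∈ S then 0 else 1 := by
        funext S; simp [Ne.symm he]
      rw [e2]
      obtain ⟨s', hs1, hs2, hs3⟩ := h.starPotential_step hX hXB hd hn u hs
      obtain ⟨t', ht1, ht2, ht3⟩ := h.starPotential_step hX hXB hd hn v ht
      have hd' : ∀ f ∈ l, ¬ f.IsDiag := fun f hf => hd f (List.mem_cons_of_mem _ hf)
      have hn' := (List.nodup_cons.1 hn).2
      have i1 := ih (fun w => (killWeight_mem hX hXB e w).1)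
        (fun w => (killWeight_mem hX hXB e w).2) hd' hn' huvl hs1 ht1
      have i2 := ih (fun w => (h.scaleWeight_mem hX hXB e w).1)
        (fun w => (h.scaleWeight_mem hX hXB e w).2) hd' hn' huvl hs2 ht2
      -- An edge other than `uv` meets at most one of `u`, `v`, so at most one factor is divided by
      -- `1 - p`.
      have mart : matchProb A x X e * (killWeight X e u * killWeight X e v) +
          (1 - matchProb A x X e) * (scaleWeight (matchProb A x X e) X e u *
            scaleWeight (matchProb A x X e) X e v) = X u * X v := by
        have hp1 : 1 - matchProb A x X e ≠ 0 := by linarith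
        have hboth : ¬ (u ∈ e ∧ v ∈ e) := fun hh =>
          he ((Sym2.mem_and_mem_iff (by simpa using hd _ huv)).1 hh)
        by_cases hu : u ∈ e <;> by_cases hv : v ∈ e
        · exact absurd ⟨hu, hv⟩ hboth
        all_goals simp only [killWeight, scaleWeight, hu, hv, if_true, if_false]
        all_goals field_simp
        all_goals ring
      have j1 := mul_le_mul_of_nonneg_left i1 hp.1
      have j2 := mul_le_mul_of_nonneg_left i2 (show 0 ≤ 1 - matchProb A x X e by linarith)
      have j3 := mul_le_mul_of_nonneg_left hs3 (mul_nonneg hx hC)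
      have j4 := mul_le_mul_of_nonneg_left ht3 (mul_nonneg hx hC)
      have j5 := congrArg (fun z => x s(u, v) * z) mart
      beta_reduce at j5
      refine le_trans ?_ (add_le_add j1 j2)
      linarith

end Marginal

/-! ### One round: choice of the parameters and exponential moments of the survivors -/

section Level

variable {V ι : Type}

/-- The requests `x` are at most `1 / q`, and the loss `lam` is large enough for this `q`. -/
structure LevelParams (lam q : ℝ) (x : Sym2 V → ℝ) : Prop where
  lam_pos : 0 < lam
  lam_le : lam ≤ 1 / 2
  q_pos : 0 < q
  sq_le : 32 ≤ lam ^ 2 * q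
  exp_le : Real.exp (-(lam ^ 3 * q / 5120)) ≤ lam ^ 3 / 128
  x_nonneg : ∀ e, 0 ≤ x e
  x_le : ∀ e, x e ≤ 1 / q

variable {lam q : ℝ} {x : Sym2 V → ℝ}

/-- With `A = 4 / lam` the cap is reached only at `s ≥ 1 - lam / 4`, whereas the initial load is at
most `1 - lam / 2`. This `θ` makes the quadratic correction a fraction `lam / 8` of the load, so
half of the gap remains. -/
theorem LevelParams.matchParams (h : LevelParams lam q x) :
    MatchParams (4 / lam) (lam ^ 2 * q / 640) (1 / q) x where
  one_le := by
    rw [le_div_iff₀ h.lam_pos]; linarith [h.lam_le]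
  theta_nonneg := by have := h.q_pos; positivity
  x_nonneg := h.x_nonneg
  x_le := h.x_le
  r_nonneg := by have := h.q_pos; positivity
  sq_le := by
    have h1 := h.q_pos
    have h2 := h.lam_pos
    have e : 1 / q * (4 / lam) ^ 2 = 16 / (lam ^ 2 * q) := by field_simp; norm_num
    rw [e, div_le_iff₀ (by positivity)]
    linarith [h.sq_le]
  theta_le := by
    have h1 := h.q_pos
    have h2 := h.lam_pos
    have e : lam ^ 2 * q / 640 * (1 / q) * (2 * (4 / lam)) = lam / 80 := by field_simp; norm_num
    rw [e]
    linarith [h.lam_le]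

variable [Fintype V]

/-- The exponent is at most `θ * ((1 + lam / 8) * (1 - lam / 2) - (1 - lam / 4)) ≤ -(θ * lam / 8)`.
Each endpoint then costs `lam / 2` of the matching probability. -/
theorem LevelParams.starPotential_le (h : LevelParams lam q x) {l : List (Sym2 V)} {u : V}
    (hu : ∑ w, starWeight x l u w ≤ 1 - lam / 2) :
    (2 * (4 / lam)) ^ 2 * Real.exp (-(lam ^ 2 * q / 640 * (1 - 1 / (4 / lam)))) *
      starPotential (lam ^ 2 * q / 640) (2 * (4 / lam)) x u 0 (fun _ => 1) l ≤ lam / 2 := by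
  have h1 := h.q_pos
  have h2 := h.lam_pos
  set θ := lam ^ 2 * q / 640 with hθ
  have hθ0 : 0 ≤ θ := by positivity
  have hy := starWeight_nonneg h.x_nonneg l u
  have hyq := starWeight_le h.x_le (by positivity : 0 ≤ 1 / q) l u
  have hpen : ∀ w, pen θ (2 * (4 / lam)) (starWeight x l u w) 1 ≤
      (θ + θ * lam / 8) * starWeight x l u w := by
    intro w
    set y := starWeight x l u w
    have e1 : 5 * θ ^ 2 * y ^ 2 * (2 * (2 * (4 / lam)) * 1 - 1 ^ 2) ≤
        5 * θ ^ 2 * y * (1 / q) * (16 / lam) := by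
      have : 2 * (2 * (4 / lam)) * 1 - 1 ^ 2 ≤ 16 / lam := by
        rw [show 2 * (2 * (4 / lam)) = 16 / lam by ring]; linarith
      have hyy : y ^ 2 ≤ y * (1 / q) := by
        rw [sq]; exact mul_le_mul_of_nonneg_left (hyq w) (hy w)
      have hy0 := hy w
      calc 5 * θ ^ 2 * y ^ 2 * (2 * (2 * (4 / lam)) * 1 - 1 ^ 2)
          ≤ 5 * θ ^ 2 * y ^ 2 * (16 / lam) := by gcongr
        _ ≤ 5 * θ ^ 2 * (y * (1 / q)) * (16 / lam) := by gcongr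
        _ = _ := by ring
    have e2 : 5 * θ ^ 2 * y * (1 / q) * (16 / lam) = θ * lam / 8 * y := by
      rw [hθ]; field_simp; ring
    unfold pen
    linarith
  have hsum : ∑ w, pen θ (2 * (4 / lam)) (starWeight x l u w) 1 ≤
      (θ + θ * lam / 8) * (1 - lam / 2) := by
    refine (Finset.sum_le_sum fun w _ => hpen w).trans ?_
    rw [← Finset.mul_sum]
    gcongr
  unfold starPotential
  rw [mul_assoc, ← Real.exp_add]
  have e3 : -(θ * (1 - 1 / (4 / lam))) +
      (θ * 0 + ∑ w, pen θ (2 * (4 / lam)) (starWeight x l u w) 1) ≤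
      -(lam ^ 3 * q / 5120) := by
    have e4 : -(lam ^ 3 * q / 5120) = -(θ * lam / 8) := by rw [hθ]; ring
    have e5 : 1 / (4 / lam) = lam / 4 := by field_simp
    rw [e4, e5]
    have : 0 ≤ θ * lam * lam := by positivity
    nlinarith
  have e6 := (Real.exp_le_exp.2 e3).trans h.exp_le
  calc (2 * (4 / lam)) ^ 2 * _ ≤ (2 * (4 / lam)) ^ 2 * (lam ^ 3 / 128) := by gcongr
    _ = lam / 2 := by field_simp; norm_num

open Classical in
/-- Every edge is matched with probability at least `(1 - lam) * x e`. -/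
theorem LevelParams.le_ex_matched (h : LevelParams lam q x) (lab : Sym2 V → ι)
    {l : List (Sym2 V)} (hd : ∀ f ∈ l, ¬ f.IsDiag) (hn : l.Nodup)
    (hW : ∀ u, ∑ w, starWeight x l u w ≤ 1 - lam / 2) {u v : V} (huv : s(u, v) ∈ l) :
    x s(u, v) * (1 - lam) ≤ (matchTree lab (4 / lam) x (fun _ => 1) l).ex
      fun S => if s(u, v) ∈ S then 0 else 1 := by
  have h2 := h.lam_pos
  have hm := h.matchParams
  have := hm.le_ex_matched lab (X := fun _ => 1) (fun _ => zero_le_one)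
    (fun _ => by linarith [hm.one_le]) hd hn huv (s := 0) (t := 0) (by norm_num) (by norm_num)
    (C := (2 * (4 / lam)) ^ 2 * Real.exp (-(lam ^ 2 * q / 640 * (1 - 1 / (4 / lam)))))
    (by positivity) (by
      rw [mul_assoc, ← Real.exp_add, neg_add_cancel, Real.exp_zero, mul_one])
  refine le_trans ?_ this
  apply mul_le_mul_of_nonneg_left _ (h.x_nonneg _)
  have k1 := h.starPotential_le (hW u)
  have k2 := h.starPotential_le (hW v)
  linarith

theorem one_sub_sum_le_prod_one_sub {κ : Type} (s : Finset κ) {f : κ → ℝ} (h0 : ∀ i, 0 ≤ f i)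
    (h1 : ∀ i, f i ≤ 1) : 1 - ∑ i ∈ s, f i ≤ ∏ i ∈ s, (1 - f i) := by
  classical
  induction s using Finset.induction_on with
  | empty => simp
  | insert a s ha ih =>
    rw [Finset.sum_insert ha, Finset.prod_insert ha]
    have h2 : ∏ i ∈ s, (1 - f i) ≤ 1 :=
      Finset.prod_le_one (fun i _ => sub_nonneg.2 (h1 i)) fun i _ => by linarith [h0 i]
    nlinarith [h0 a]

/-- The product of `1 + a e` over the edges `e` of `S` at `v`. -/
noncomputable def starProd (a : Sym2 V → ℝ) (S : List (Sym2 V)) (v : V) : ℝ :=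
  ∏ w, (1 + starWeight a S v w)

-- At most one edge at `v` is removed, so at most one factor changes and the product of the
-- corrections has no cross terms.
open Classical in
theorem starProd_le_of_isMatchedOut {a : Sym2 V → ℝ} (ha : ∀ e, 0 ≤ a e) {l S : List (Sym2 V)}
    (hS : IsMatchedOut l S) (v : V) :
    starProd a S v ≤ starProd a l v * (1 - ∑ w, a s(v, w) / (1 + a s(v, w)) *
      if s(v, w) ∈ l then (if s(v, w) ∈ S then 0 else 1) else 0) := by
  set m : V → ℝ := fun w => if s(v, w) ∈ l then (if s(v, w) ∈ S then 0 else 1) else 0 with hm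
  have hterm : ∀ w, 1 + starWeight a S v w =
      (1 + starWeight a l v w) * (1 - a s(v, w) / (1 + a s(v, w)) * m w) := by
    intro w
    have h1 : 1 + a s(v, w) ≠ 0 := by linarith [ha s(v, w)]
    by_cases hl : s(v, w) ∈ l
    · by_cases hs : s(v, w) ∈ S
      · simp [starWeight, hm, hl, hs]
      · simp only [starWeight, hm, hl, hs, if_true, if_false]
        field_simp
        ring
    · have hs : s(v, w) ∉ S := fun hh => hl (hS.1.subset hh)
      simp [starWeight, hm, hl, hs]
  have hprod : ∏ w, (1 - a s(v, w) / (1 + a s(v, w)) * m w) =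
      1 - ∑ w, a s(v, w) / (1 + a s(v, w)) * m w := by
    by_cases hex : ∃ w, m w ≠ 0
    · obtain ⟨w, hw⟩ := hex
      have hw' : s(v, w) ∈ l ∧ s(v, w) ∉ S := by
        by_contra hc
        apply hw
        simp only [hm]
        split_ifs with h1 h2
        · rfl
        · exact absurd ⟨h1, h2⟩ hc
        · rfl
      have hz : ∀ w', w' ≠ w → m w' = 0 := by
        intro w' hne
        simp only [hm]
        split_ifs with h1 h2
        · rfl
        · have := hS.2 v _ h1 _ hw'.1 (Sym2.mem_mk_left _ _) (Sym2.mem_mk_left _ _) h2 hw'.2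
          exact absurd (Sym2.congr_right.1 this) hne
        · rfl
      rw [Fintype.prod_eq_single w (fun w' hne => by rw [hz w' hne, mul_zero, sub_zero]),
        Fintype.sum_eq_single w (fun w' hne => by rw [hz w' hne, mul_zero])]
    · push Not at hex
      simp [hex]
  unfold starProd
  rw [Finset.prod_congr rfl fun w _ => hterm w, Finset.prod_mul_distrib, hprod]

-- With `b = a / (1 - ξ)`, the expectation is at most `∏ (1 + b)` times `1 - ∑ b / (1 + b) * ξ`. The
-- latter is at most `∏ (1 - b / (1 + b) * ξ)`, which turns each factor `1 + b` into `1 + b * (1 -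
-- ξ) = 1 + a`, as for independent removals.
open Classical in
theorem LevelParams.ex_starProd_le (h : LevelParams lam q x) (lab : Sym2 V → ι)
    {l : List (Sym2 V)} (hd : ∀ f ∈ l, ¬ f.IsDiag) (hn : l.Nodup)
    (hW : ∀ u, ∑ w, starWeight x l u w ≤ 1 - lam / 2) {a ξ : Sym2 V → ℝ} (ha : ∀ e, 0 ≤ a e)
    (hξ0 : ∀ e, 0 ≤ ξ e) (hξ1 : ∀ e, ξ e < 1) (hξ : ∀ e, ξ e ≤ x e * (1 - lam)) (v : V) :
    (matchTree lab (4 / lam) x (fun _ => 1) l).ex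
      (fun S => starProd (fun e => a e / (1 - ξ e)) S v) ≤ starProd a l v := by
  set b : Sym2 V → ℝ := fun e => a e / (1 - ξ e) with hb
  have hb0 : ∀ e, 0 ≤ b e := fun e => div_nonneg (ha e) (by linarith [hξ1 e])
  have hP0 : 0 ≤ starProd b l v :=
    Finset.prod_nonneg fun w _ => by linarith [starWeight_nonneg hb0 l v w]
  set T := matchTree lab (4 / lam) x (fun _ => 1) l
  have hδ : ∀ w, 0 ≤ b s(v, w) / (1 + b s(v, w)) := fun w =>
    div_nonneg (hb0 _) (by linarith [hb0 s(v, w)])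
  have hδ1 : ∀ w, b s(v, w) / (1 + b s(v, w)) ≤ 1 := fun w => by
    rw [div_le_one (by linarith [hb0 s(v, w)])]; linarith
  refine (CoinTree.ex_le_ex (matchTree_all lab (4 / lam) x (fun _ => 1) l)
    (fun S hS => starProd_le_of_isMatchedOut hb0 hS v)).trans ?_
  have e1 : (fun S : List (Sym2 V) => starProd b l v * (1 - ∑ w, b s(v, w) / (1 + b s(v, w)) *
      if s(v, w) ∈ l then (if s(v, w) ∈ S then (0 : ℝ) else 1) else 0)) =
      fun S : List (Sym2 V) => starProd b l v + (-starProd b l v) * ∑ w, b s(v, w) / (1 + b s(v, w)) *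
      if s(v, w) ∈ l then (if s(v, w) ∈ S then (0 : ℝ) else 1) else 0 := by
    funext S; ring
  rw [e1, CoinTree.ex_add, CoinTree.ex_const, CoinTree.ex_const_mul, CoinTree.ex_sum]
  simp only [CoinTree.ex_const_mul]
  set g : V → ℝ := fun w => if s(v, w) ∈ l then ξ s(v, w) else 0 with hg
  have hg0 : ∀ w, 0 ≤ g w := fun w => by simp only [hg]; split_ifs <;> [exact hξ0 _; exact le_rfl]
  have hg1 : ∀ w, g w ≤ 1 := fun w => by
    simp only [hg]; split_ifs <;> [exact (hξ1 _).le; exact zero_le_one]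
  have step2 : ∑ w, b s(v, w) / (1 + b s(v, w)) * g w ≤ ∑ w, b s(v, w) / (1 + b s(v, w)) *
      T.ex (fun S => if s(v, w) ∈ l then (if s(v, w) ∈ S then (0 : ℝ) else 1) else 0) := by
    refine Finset.sum_le_sum fun w _ => mul_le_mul_of_nonneg_left ?_ (hδ w)
    by_cases hl : s(v, w) ∈ l
    · simp only [hg, hl, if_true]
      exact (hξ _).trans (h.le_ex_matched lab hd hn hW hl)
    · simp only [hg, hl, if_false, CoinTree.ex_const, le_refl]
  have step3 := one_sub_sum_le_prod_one_sub Finset.univ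
    (fun w => mul_nonneg (hδ w) (hg0 w)) (fun w => mul_le_one₀ (hδ1 w) (hg0 w) (hg1 w))
  have step4 : starProd b l v * ∏ w, (1 - b s(v, w) / (1 + b s(v, w)) * g w) =
      starProd a l v := by
    unfold starProd
    rw [← Finset.prod_mul_distrib]
    refine Finset.prod_congr rfl fun w _ => ?_
    by_cases hl : s(v, w) ∈ l
    · have h1 : 1 - ξ s(v, w) ≠ 0 := by linarith [hξ1 s(v, w)]
      have h2 : 1 + b s(v, w) ≠ 0 := by linarith [hb0 s(v, w)]
      have h3 : a s(v, w) = b s(v, w) * (1 - ξ s(v, w)) := by simp only [hb]; field_simp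
      simp only [starWeight, hg, hl, if_true, h3]
      field_simp
      ring
    · simp [starWeight, hg, hl]
  rw [← step4]
  have := mul_le_mul_of_nonneg_left (step2.trans' le_rfl) hP0
  have := mul_le_mul_of_nonneg_left step3 hP0
  linarith

end Level

/-! ### Iterating the rounds: union bound by a pessimistic estimator -/

section Rounds

/-- The loss rates `lam` and the lower bounds `q` on the inverse requests of the successive rounds
of the coloring algorithm. -/
structure Rates (lam q : ℕ → ℝ) : Prop where
  lam_pos : ∀ i, 0 < lam i
  lam_le : ∀ i, lam i ≤ 1 / 2
  sq_le : ∀ i, 32 ≤ lam i ^ 2 * q i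
  exp_le : ∀ i, Real.exp (-(lam i ^ 3 * q i / 5120)) ≤ lam i ^ 3 / 128

open Classical in
/-- The nominal number of colors still to come, before round `i`, for an edge with `d` colors. -/
noncomputable def remaining (lam q : ℕ → ℝ) (d : ℝ) : ℕ → ℝ
  | 0 => d
  | i + 1 => if q i ≤ remaining lam q d i then remaining lam q d i - (1 - 2 * lam i)
      else remaining lam q d i

open Classical in
/-- The request of an edge with `d` colors in round `i`. -/
noncomputable def request (lam q : ℕ → ℝ) (d : ℝ) (i : ℕ) : ℝ :=
  if q i ≤ remaining lam q d i then (1 - lam i) / remaining lam q d i else 0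

variable {lam q : ℕ → ℝ}

theorem Rates.q_ge (h : Rates lam q) (i : ℕ) : 128 ≤ q i := by
  have h1 := h.sq_le i
  have h2 := h.lam_le i
  have h3 := h.lam_pos i
  have h4 : lam i ^ 2 ≤ 1 / 4 := by nlinarith
  by_contra hc
  push Not at hc
  have h5 : 0 < lam i ^ 2 := by positivity
  nlinarith [mul_lt_mul_of_pos_left hc h5]

theorem Rates.remaining_pos (h : Rates lam q) {d : ℝ} (hd : 0 < d) (i : ℕ) :
    0 < remaining lam q d i := by
  induction i with
  | zero => exact hd
  | succ i ih =>
    rw [remaining]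
    split_ifs with hq
    · linarith [h.q_ge i, h.lam_pos i]
    · exact ih

theorem Rates.request_nonneg (h : Rates lam q) {d : ℝ} (hd : 0 < d) (i : ℕ) :
    0 ≤ request lam q d i := by
  unfold request
  split_ifs
  · exact div_nonneg (by linarith [h.lam_le i]) (h.remaining_pos hd i).le
  · exact le_rfl

theorem Rates.request_le (h : Rates lam q) {d : ℝ} (hd : 0 < d) (i : ℕ) :
    request lam q d i ≤ 1 / q i := by
  have hq : 0 < q i := by linarith [h.q_ge i]
  unfold request
  split_ifs with hc
  · rw [div_le_div_iff₀ (h.remaining_pos hd i) hq]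
    nlinarith [h.lam_pos i]
  · positivity

theorem Rates.request_mul_le (h : Rates lam q) {d : ℝ} (hd : 0 < d) (i : ℕ) :
    request lam q d i * remaining lam q d i ≤ 1 - lam i := by
  have := h.remaining_pos hd i
  unfold request
  split_ifs with hc
  · rw [div_mul_cancel₀ _ this.ne']
  · linarith [h.lam_le i]

/-- The relative decrease of `remaining` is at most the guaranteed matching probability. -/
theorem Rates.remaining_succ (h : Rates lam q) {d : ℝ} (hd : 0 < d) (i : ℕ) :
    ∃ ξ, 0 ≤ ξ ∧ ξ < 1 ∧ ξ ≤ request lam q d i * (1 - lam i) ∧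
      remaining lam q d (i + 1) = remaining lam q d i * (1 - ξ) := by
  have h1 := h.remaining_pos hd i
  have h2 := h.lam_le i
  have h3 := h.lam_pos i
  by_cases hc : q i ≤ remaining lam q d i
  -- One factor `1 - lam` is in the request and one is lost in the matching; `1 - 2 * lam ≤ (1 -
  -- lam) ^ 2`.
  · refine ⟨(1 - 2 * lam i) / remaining lam q d i, div_nonneg (by linarith) h1.le, ?_, ?_, ?_⟩
    · rw [div_lt_one h1]
      linarith [h.q_ge i]
    · rw [request, if_pos hc, div_mul_eq_mul_div]
      gcongr
      nlinarith
    · rw [remaining, if_pos hc]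
      field_simp
  · exact ⟨0, le_rfl, one_pos, by simp [request, hc], by simp [remaining, hc]⟩

variable {V ι : Type}

theorem Rates.levelParams (h : Rates lam q) {d : Sym2 V → ℝ} (hd : ∀ e, 0 < d e) (i : ℕ) :
    LevelParams (lam i) (q i) fun e => request lam q (d e) i where
  lam_pos := h.lam_pos i
  lam_le := h.lam_le i
  q_pos := by linarith [h.q_ge i]
  sq_le := h.sq_le i
  exp_le := h.exp_le i
  x_nonneg e := h.request_nonneg (hd e) i
  x_le e := h.request_le (hd e) i

/-- One round of the coloring algorithm: the survivors of `S` in round `i`. -/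
noncomputable def roundTree (lab : ℕ → Sym2 V → ι) (lam q : ℕ → ℝ) (d : Sym2 V → ℝ) (i : ℕ)
    (S : List (Sym2 V)) : CoinTree ι (List (Sym2 V)) :=
  matchTree (lab i) (4 / lam i) (fun e => request lam q (d e) i) (fun _ => 1) S

/-- The survivors after the first `m` rounds. -/
noncomputable def roundsTree (lab : ℕ → Sym2 V → ι) (lam q : ℕ → ℝ) (d : Sym2 V → ℝ)
    (S : List (Sym2 V)) : ℕ → CoinTree ι (List (Sym2 V))
  | 0 => .ret S
  | m + 1 => .bind (roundTree lab lam q d m) (roundsTree lab lam q d S m)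

theorem roundsTree_all (lab : ℕ → Sym2 V → ι) (lam q : ℕ → ℝ) (d : Sym2 V → ℝ)
    (S : List (Sym2 V)) (m : ℕ) : (roundsTree lab lam q d S m).All fun S' => S'.Sublist S := by
  induction m with
  | zero => exact List.Sublist.refl S
  | succ m ih =>
    exact ih.bind fun S' hS' => (matchTree_all _ _ _ _ _).mono fun T hT => hT.1.trans hS'

theorem roundsTree_fresh {lab : ℕ → Sym2 V → ι} (lam q : ℕ → ℝ) (d : Sym2 V → ℝ)
    {S : List (Sym2 V)} (hn : S.Nodup) {K : ℕ}
    (hlab : ∀ i < K, ∀ j < K, ∀ e f, lab i e = lab j f → i = j ∧ e = f) {m : ℕ} (hm : m ≤ K) :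
    (roundsTree lab lam q d S m).Fresh {a | ∃ i < m, ∃ e, lab i e = a} := by
  induction m with
  | zero => trivial
  | succ m ih =>
    have hd : Disjoint {a | ∃ i < m, ∃ e, lab i e = a} {a | ∃ e, lab m e = a} := by
      rw [Set.disjoint_left]
      rintro a ⟨i, hi, e, rfl⟩ ⟨f, hf⟩
      have := (hlab m (by omega) i (by omega) f e hf).1
      omega
    refine ((ih (by omega)).bind hd (roundsTree_all lab lam q d S m) fun S' hS' => ?_).mono
      (T := {a | ∃ i < m + 1, ∃ e, lab i e = a}) ?_
    · have hinj : Function.Injective (lab m) := fun e f hef =>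
        (hlab m (by omega) m (by omega) e f hef).2
      refine (matchTree_fresh hinj _ _ _ (hn.sublist hS')).mono ?_
      rintro _ ⟨e, -, rfl⟩
      exact ⟨e, rfl⟩
    · rintro a (⟨i, hi, e, rfl⟩ | ⟨e, rfl⟩)
      · exact ⟨i, by omega, e, rfl⟩
      · exact ⟨m, by omega, e, rfl⟩

variable [Fintype V]

theorem starProd_exp (t : Sym2 V → ℝ) (S : List (Sym2 V)) (u : V) :
    starProd (fun e => Real.exp (t e) - 1) S u = Real.exp (∑ w, starWeight t S u w) := by
  rw [starProd, Real.exp_sum]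
  refine Finset.prod_congr rfl fun w _ => ?_
  unfold starWeight
  split_ifs <;> simp

theorem starProd_le_exp {a : Sym2 V → ℝ} (ha : ∀ e, 0 ≤ a e) (S : List (Sym2 V)) (u : V) :
    starProd a S u ≤ Real.exp (∑ w, starWeight a S u w) := by
  rw [starProd, Real.exp_sum]
  refine Finset.prod_le_prod (fun w _ => by linarith [starWeight_nonneg ha S u w]) fun w _ => ?_
  rw [add_comm]
  exact Real.add_one_le_exp _

theorem sum_starWeight_le_sum {a b : Sym2 V → ℝ} (hab : ∀ e, a e ≤ b e) (S : List (Sym2 V))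
    (u : V) : ∑ w, starWeight a S u w ≤ ∑ w, starWeight b S u w := by
  refine Finset.sum_le_sum fun w _ => ?_
  unfold starWeight
  split_ifs
  exacts [hab _, le_rfl]

theorem sum_starWeight_const_mul (c : ℝ) (a : Sym2 V → ℝ) (S : List (Sym2 V)) (u : V) :
    ∑ w, starWeight (fun e => c * a e) S u w = c * ∑ w, starWeight a S u w := by
  rw [Finset.mul_sum]
  refine Finset.sum_congr rfl fun w _ => ?_
  unfold starWeight
  split_ifs <;> simp

/-- The pessimistic estimator, before round `i`, for the event that for some round `j ≥ i` and
vertex `u` the sum of `t j` over the surviving edges at `u` is too large. -/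
noncomputable def estimator (lam q : ℕ → ℝ) (d : Sym2 V → ℝ) (t : ℕ → Sym2 V → ℝ)
    (c : ℕ → V → ℝ) (K i : ℕ) (S : List (Sym2 V)) : ℝ :=
  ∑ j ∈ Finset.Icc i K, ∑ u, c j u *
    starProd (fun e => (Real.exp (t j e) - 1) * remaining lam q (d e) j /
      remaining lam q (d e) i) S u

variable {d : Sym2 V → ℝ} {t : ℕ → Sym2 V → ℝ} {c : ℕ → V → ℝ} {K : ℕ}

theorem Rates.starProd_nonneg (h : Rates lam q) (hd : ∀ e, 0 < d e) (ht : ∀ j e, 0 ≤ t j e)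
    (i j : ℕ) (S : List (Sym2 V)) (u : V) :
    0 ≤ starProd (fun e => (Real.exp (t j e) - 1) * remaining lam q (d e) j /
      remaining lam q (d e) i) S u := by
  refine Finset.prod_nonneg fun w _ => ?_
  have := starWeight_nonneg (x := fun e => (Real.exp (t j e) - 1) * remaining lam q (d e) j /
      remaining lam q (d e) i) (fun e => div_nonneg (mul_nonneg
      (sub_nonneg.2 (Real.one_le_exp (ht j e))) (h.remaining_pos (hd e) j).le)
      (h.remaining_pos (hd e) i).le) S u w
  linarith

/-- In the summand `j = i` the ratio of remaining colors is `1`, and the product collapses to an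
exponential. -/
theorem Rates.le_estimator (h : Rates lam q) (hd : ∀ e, 0 < d e) (ht : ∀ j e, 0 ≤ t j e)
    (hc : ∀ j u, 0 ≤ c j u) {i : ℕ} (hi : i ≤ K) (S : List (Sym2 V)) (u : V) :
    c i u * Real.exp (∑ w, starWeight (t i) S u w) ≤ estimator lam q d t c K i S := by
  have hnn : ∀ j v, 0 ≤ c j v * starProd (fun e => (Real.exp (t j e) - 1) *
      remaining lam q (d e) j / remaining lam q (d e) i) S v := fun j v =>
    mul_nonneg (hc j v) (h.starProd_nonneg hd ht i j S v)
  have e1 : (fun e => (Real.exp (t i e) - 1) * remaining lam q (d e) i /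
      remaining lam q (d e) i) = fun e => Real.exp (t i e) - 1 := by
    funext e
    rw [mul_div_cancel_right₀ _ (h.remaining_pos (hd e) i).ne']
  have h1 := Finset.single_le_sum (f := fun v => c i v * starProd (fun e =>
      (Real.exp (t i e) - 1) * remaining lam q (d e) i / remaining lam q (d e) i) S v)
    (fun v _ => hnn i v) (Finset.mem_univ u)
  have h2 := Finset.single_le_sum (f := fun j => ∑ v, c j v * starProd (fun e =>
      (Real.exp (t j e) - 1) * remaining lam q (d e) j / remaining lam q (d e) i) S v)
    (fun j _ => Finset.sum_nonneg fun v _ => hnn j v)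
    (Finset.mem_Icc.2 ⟨le_rfl, hi⟩ : i ∈ Finset.Icc i K)
  refine le_trans (le_of_eq ?_) (h1.trans h2)
  simp only [e1, starProd_exp]

/-- If all loads are admissible, each summand is a supermartingale, because `remaining` shrinks by
the factor `1 - ξ`. If a load is too large, `hlarge` makes the estimator at least `1`, and the
truncation at `1` makes the claim trivial. -/
theorem Rates.ex_estimator_le (h : Rates lam q) (hd : ∀ e, 0 < d e) (ht : ∀ j e, 0 ≤ t j e)
    (hc : ∀ j u, 0 ≤ c j u) (lab : ℕ → Sym2 V → ι) {i : ℕ} (hi : i < K)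
    (hlarge : ∀ (S : List (Sym2 V)) u,
      1 - lam i / 2 < ∑ w, starWeight (fun e => request lam q (d e) i) S u w →
      1 ≤ c i u * Real.exp (∑ w, starWeight (t i) S u w))
    {S : List (Sym2 V)} (hS : ∀ f ∈ S, ¬ f.IsDiag) (hn : S.Nodup) :
    (roundTree lab lam q d i S).ex (fun S' => min 1 (estimator lam q d t c K (i + 1) S')) ≤
      min 1 (estimator lam q d t c K i S) := by
  apply le_min
  · exact (CoinTree.ex_mono _ fun S' => min_le_left _ _).trans_eq (CoinTree.ex_const 1 _)
  by_cases hW : ∀ u, ∑ w, starWeight (fun e => request lam q (d e) i) S u w ≤ 1 - lam i / 2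
  · refine (CoinTree.ex_mono _ fun S' => min_le_right _ _).trans ?_
    unfold estimator
    simp only [CoinTree.ex_sum, CoinTree.ex_const_mul]
    choose ξ hξ0 hξ1 hξ2 hξ3 using fun e => h.remaining_succ (hd e) i
    refine le_trans (Finset.sum_le_sum fun j hj => Finset.sum_le_sum fun u _ =>
      mul_le_mul_of_nonneg_left (?_ : _ ≤ starProd (fun e => (Real.exp (t j e) - 1) *
        remaining lam q (d e) j / remaining lam q (d e) i) S u) (hc j u))
      (Finset.sum_le_sum_of_subset_of_nonneg (Finset.Icc_subset_Icc_left (Nat.le_succ i))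
        fun j _ _ => Finset.sum_nonneg fun u _ =>
          mul_nonneg (hc j u) (h.starProd_nonneg hd ht i j S u))
    have := (h.levelParams hd i).ex_starProd_le (lab i) hS hn hW
      (a := fun e => (Real.exp (t j e) - 1) * remaining lam q (d e) j / remaining lam q (d e) i)
      (fun e => div_nonneg (mul_nonneg (sub_nonneg.2 (Real.one_le_exp (ht j e)))
        (h.remaining_pos (hd e) j).le) (h.remaining_pos (hd e) i).le) hξ0 hξ1 hξ2 u
    refine le_trans (le_of_eq ?_) this
    simp only [hξ3, div_div]
    rfl
  · push Not at hW
    obtain ⟨u, hu⟩ := hW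
    refine le_trans ?_ ((hlarge S u hu).trans (h.le_estimator hd ht hc hi.le S u))
    exact (CoinTree.ex_mono _ fun S' => min_le_left _ _).trans_eq (CoinTree.ex_const 1 _)

theorem Rates.ex_rounds_estimator_le (h : Rates lam q) (hd : ∀ e, 0 < d e)
    (ht : ∀ j e, 0 ≤ t j e) (hc : ∀ j u, 0 ≤ c j u) (lab : ℕ → Sym2 V → ι)
    (hlarge : ∀ i < K, ∀ (S : List (Sym2 V)) u,
      1 - lam i / 2 < ∑ w, starWeight (fun e => request lam q (d e) i) S u w →
      1 ≤ c i u * Real.exp (∑ w, starWeight (t i) S u w))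
    {S : List (Sym2 V)} (hS : ∀ f ∈ S, ¬ f.IsDiag) (hn : S.Nodup) {m : ℕ} (hm : m ≤ K) :
    (roundsTree lab lam q d S m).ex (fun S' => min 1 (estimator lam q d t c K m S')) ≤
      estimator lam q d t c K 0 S := by
  induction m with
  | zero => exact min_le_right _ _
  | succ m ih =>
    refine le_trans ?_ (ih (by omega))
    rw [roundsTree, CoinTree.ex_bind]
    exact CoinTree.ex_le_ex (roundsTree_all lab lam q d S m) fun S' hS' =>
      h.ex_estimator_le hd ht hc lab (by omega) (hlarge m (by omega))
        (fun f hf => hS f (hS'.subset hf)) (hn.sublist hS')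

theorem exp_sub_one_le {z : ℝ} (h0 : 0 ≤ z) (h1 : z ≤ 1) : Real.exp z - 1 ≤ z + z ^ 2 := by
  have := exp_le_one_add_sq (abs_le.2 ⟨by linarith, h1⟩)
  linarith

open Classical in
/-- The number of edges that survive all rounds is small at every vertex, with high probability. -/
theorem Rates.ex_rounds_large_le (h : Rates lam q) (hd : ∀ e, 0 < d e) (lab : ℕ → Sym2 V → ι)
    {S : List (Sym2 V)} (hS : ∀ f ∈ S, ¬ f.IsDiag) (hn : S.Nodup)
    (hdeg : ∀ u, ∑ w, starWeight (fun e => 1 / d e) S u w ≤ 1) {Q : V → ℝ}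
    (hQ : ∀ u, ∑ w, starWeight (fun e => remaining lam q (d e) K / d e) S u w ≤ Q u) {δ : ℝ}
    (hδ : ∀ i < K, Real.exp (-(lam i ^ 2 * q i / 16)) ≤ δ) (hδQ : ∀ u, Real.exp (-Q u) ≤ δ) :
    (roundsTree lab lam q d S K).ex
      (fun S' => if ∃ u, 3 * Q u < ∑ w, starWeight (fun _ => 1) S' u w then 1 else 0) ≤
      (K + 1) * Fintype.card V * δ := by
  -- This value minimizes the exponent `θ ^ 2 / q - θ * lam / 2`, with minimum `-(lam ^ 2 * q /
  -- 16)`.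
  set θ : ℕ → ℝ := fun i => lam i * q i / 4 with hθ
  have hθ0 : ∀ i, 0 ≤ θ i := fun i => by
    have := h.lam_pos i
    have := h.q_ge i
    simp only [hθ]
    positivity
  -- Indices below `K` test the load of a round. Index `K` counts the final survivors: as `exp 1 - 1
  -- ≤ 2`, the threshold `3 * Q u` leaves `exp (2 * Q u - 3 * Q u)`.
  set t : ℕ → Sym2 V → ℝ := fun j e => if j < K then θ j * request lam q (d e) j else 1 with htdef
  set c : ℕ → V → ℝ := fun j u =>
    if j < K then Real.exp (-(θ j * (1 - lam j / 2))) else Real.exp (-(3 * Q u)) with hcdef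
  have ht : ∀ j e, 0 ≤ t j e := by
    intro j e
    simp only [htdef]
    split_ifs
    · exact mul_nonneg (hθ0 j) (h.request_nonneg (hd e) j)
    · exact zero_le_one
  have hc : ∀ j u, 0 ≤ c j u := by
    intro j u
    simp only [hcdef]
    split_ifs <;> positivity
  have hlarge : ∀ i < K, ∀ (S : List (Sym2 V)) u,
      1 - lam i / 2 < ∑ w, starWeight (fun e => request lam q (d e) i) S u w →
      1 ≤ c i u * Real.exp (∑ w, starWeight (t i) S u w) := by
    intro i hi S u hu
    simp only [htdef, hcdef, hi, if_true]
    rw [sum_starWeight_const_mul, ← Real.exp_add]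
    apply Real.one_le_exp
    have := mul_le_mul_of_nonneg_left hu.le (hθ0 i)
    linarith
  have main := h.ex_rounds_estimator_le hd ht hc lab hlarge hS hn le_rfl
  have hstart : estimator lam q d t c K 0 S ≤ (K + 1) * Fintype.card V * δ := by
    have hterm : ∀ j ∈ Finset.Icc 0 K, ∀ u ∈ (Finset.univ : Finset V), c j u *
        starProd (fun e => (Real.exp (t j e) - 1) * remaining lam q (d e) j /
          remaining lam q (d e) 0) S u ≤ δ := by
      intro j hj u _
      have hnn : ∀ e, 0 ≤ (Real.exp (t j e) - 1) * remaining lam q (d e) j /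
          remaining lam q (d e) 0 := fun e => div_nonneg (mul_nonneg
        (sub_nonneg.2 (Real.one_le_exp (ht j e))) (h.remaining_pos (hd e) j).le) (hd e).le
      refine (mul_le_mul_of_nonneg_left (starProd_le_exp hnn S u) (hc j u)).trans ?_
      by_cases hjK : j < K
      · have hl0 := h.lam_pos j
        have hl1 := h.lam_le j
        have hq0 : 0 < q j := by linarith [h.q_ge j]
        have hpt : ∀ e, (Real.exp (t j e) - 1) * remaining lam q (d e) j /
            remaining lam q (d e) 0 ≤ ((θ j + θ j ^ 2 / q j) * (1 - lam j)) * (1 / d e) := by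
          intro e
          have hr0 := h.remaining_pos (hd e) j
          have hx0 := h.request_nonneg (hd e) j
          have hx1 := h.request_le (hd e) j
          have hxr := h.request_mul_le (hd e) j
          have e1 : remaining lam q (d e) 0 = d e := rfl
          have hθq : θ j * request lam q (d e) j ≤ θ j / q j := by
            rw [div_eq_mul_one_div]
            exact mul_le_mul_of_nonneg_left hx1 (hθ0 j)
          have hθq1 : θ j / q j ≤ 1 := by
            simp only [hθ]
            rw [div_le_one hq0]
            nlinarith
          rw [e1, mul_one_div]
          apply div_le_div_of_nonneg_right _ (hd e).le
          simp only [htdef, hjK, if_true]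
          set x := request lam q (d e) j
          have k1 := exp_sub_one_le (mul_nonneg (hθ0 j) hx0) (hθq.trans hθq1)
          have k2 : θ j * x + (θ j * x) ^ 2 ≤ x * (θ j + θ j ^ 2 / q j) := by
            have := mul_le_mul_of_nonneg_left hθq (mul_nonneg (hθ0 j) hx0)
            have e2 : θ j ^ 2 / q j = θ j * (θ j / q j) := by ring
            rw [e2]
            linarith
          calc (Real.exp (θ j * x) - 1) * remaining lam q (d e) j
              ≤ (x * (θ j + θ j ^ 2 / q j)) * remaining lam q (d e) j := by
                gcongr
                exact k1.trans k2
            _ = (θ j + θ j ^ 2 / q j) * (x * remaining lam q (d e) j) := by ring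
            _ ≤ _ := by
                have := hθ0 j
                gcongr
        have hsum := sum_starWeight_le_sum hpt S u
        rw [sum_starWeight_const_mul] at hsum
        have hcoef : 0 ≤ (θ j + θ j ^ 2 / q j) * (1 - lam j) := by
          have := hθ0 j
          have : 0 ≤ 1 - lam j := by linarith
          positivity
        have hsum' := hsum.trans (mul_le_mul_of_nonneg_left (hdeg u) hcoef)
        refine le_trans ?_ (hδ j hjK)
        simp only [hcdef, hjK, if_true]
        rw [← Real.exp_add, Real.exp_le_exp]
        have e3 : θ j ^ 2 / q j = lam j ^ 2 * q j / 16 := by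
          simp only [hθ]
          field_simp
          norm_num
        have e4 : θ j * lam j = lam j ^ 2 * q j / 4 := by simp only [hθ]; ring
        rw [e3] at hsum'
        have : 0 ≤ lam j ^ 2 * q j / 16 * lam j := by positivity
        nlinarith
      · have hjK' : j = K := le_antisymm (Finset.mem_Icc.1 hj).2 (not_lt.1 hjK)
        subst hjK'
        have hpt : ∀ e, (Real.exp (t j e) - 1) * remaining lam q (d e) j /
            remaining lam q (d e) 0 ≤ 2 * (remaining lam q (d e) j / d e) := by
          intro e
          have e1 : remaining lam q (d e) 0 = d e := rfl
          have hr0 := h.remaining_pos (hd e) j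
          simp only [htdef, hjK, if_false]
          rw [e1, ← mul_div_assoc]
          apply div_le_div_of_nonneg_right _ (hd e).le
          gcongr
          have := exp_sub_one_le zero_le_one (le_refl (1 : ℝ))
          linarith
        have hsum := sum_starWeight_le_sum hpt S u
        rw [sum_starWeight_const_mul] at hsum
        refine le_trans ?_ (hδQ u)
        simp only [hcdef, hjK, if_false]
        rw [← Real.exp_add, Real.exp_le_exp]
        linarith [hQ u]
    refine (Finset.sum_le_sum fun j hj => Finset.sum_le_sum (hterm j hj)).trans_eq ?_
    simp only [Finset.sum_const, Nat.card_Icc, Finset.card_univ, nsmul_eq_mul]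
    push_cast
    ring
  refine le_trans (CoinTree.ex_mono _ fun S' => ?_) (main.trans hstart)
  split_ifs with hex
  · obtain ⟨u, hu⟩ := hex
    refine le_min le_rfl (le_trans ?_ (h.le_estimator hd ht hc le_rfl S' u))
    have e5 : t K = fun _ => 1 := by
      funext e
      simp [htdef]
    have e6 : c K u = Real.exp (-(3 * Q u)) := by simp [hcdef]
    rw [e5, e6, ← Real.exp_add]
    apply Real.one_le_exp
    linarith
  · refine le_min zero_le_one (Finset.sum_nonneg fun j _ => Finset.sum_nonneg fun u _ => ?_)
    exact mul_nonneg (hc j u) (h.starProd_nonneg hd ht K j S' u)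

end Rounds

/-! ### The schedule of loss rates and the life span of an edge -/

section Schedule

/-- The relative loss at scale `y`. -/
noncomputable def lossRate (L y : ℝ) : ℝ :=
  10 * √(Real.log y / √y) + 100 * (L / y) ^ (1 / 3 : ℝ)

/-- The absolute loss at scale `y`. -/
noncomputable def slack (L y : ℝ) : ℝ := y * lossRate L y

/-- `y` is large enough, both absolutely and compared to `L`. -/
structure IsLargeScale (L y : ℝ) : Prop where
  L_ge : 1 / 2 ≤ L
  ge : 10 ^ 20 ≤ y
  ge_mul : 10 ^ 20 * L ≤ y

variable {L y z : ℝ}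

theorem IsLargeScale.mono (h : IsLargeScale L y) (hyz : y ≤ z) : IsLargeScale L z :=
  ⟨h.L_ge, h.ge.trans hyz, h.ge_mul.trans hyz⟩

theorem IsLargeScale.pos (h : IsLargeScale L y) : 0 < y := lt_of_lt_of_le (by norm_num) h.ge

theorem IsLargeScale.one_le_log (h : IsLargeScale L y) : 1 ≤ Real.log y := by
  rw [Real.le_log_iff_exp_le h.pos]
  have := Real.exp_one_lt_d9
  linarith [h.ge]

theorem log_div_sqrt_le (h : Real.exp 2 ≤ y) (hyz : y ≤ z) :
    Real.log z / √z ≤ Real.log y / √y := by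
  have h2 : Real.exp ((1 / 2 : ℝ)⁻¹) ≤ y := by
    rwa [one_div, inv_inv]
  have := Real.log_div_self_rpow_antitoneOn (a := 1 / 2) (by norm_num)
    (Set.mem_Ici.2 h2) (Set.mem_Ici.2 (h2.trans hyz)) hyz
  simpa only [Real.sqrt_eq_rpow] using this

theorem exp_two_le : Real.exp 2 ≤ 10 ^ 20 := by
  have : Real.exp 2 = Real.exp 1 ^ 2 := by
    rw [← Real.exp_nat_mul]; norm_num
  rw [this]
  have h1 := Real.exp_one_lt_d9
  have h0 := Real.exp_pos 1
  nlinarith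

theorem IsLargeScale.lossRate_anti (h : IsLargeScale L y) (hyz : y ≤ z) :
    lossRate L z ≤ lossRate L y := by
  have h1 := log_div_sqrt_le (exp_two_le.trans h.ge) hyz
  have h2 := h.pos
  have h3 : 0 ≤ L := by linarith [h.L_ge]
  have h4 : 0 < z := by linarith
  unfold lossRate
  gcongr

theorem IsLargeScale.cube_root_le (h : IsLargeScale L y) : (L / y) ^ (1 / 3 : ℝ) ≤ 1 / 10 ^ 6 := by
  have h1 : L / y ≤ (1 / 10 ^ 6) ^ (3 : ℝ) := by
    rw [div_le_iff₀ h.pos]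
    have := h.ge_mul
    norm_num
    linarith [h.L_ge]
  have h0 : 0 ≤ L / y := div_nonneg (by linarith [h.L_ge]) h.pos.le
  calc (L / y) ^ (1 / 3 : ℝ) ≤ ((1 / 10 ^ 6 : ℝ) ^ (3 : ℝ)) ^ (1 / 3 : ℝ) := by gcongr
    _ = 1 / 10 ^ 6 := by rw [← Real.rpow_mul (by norm_num)]; norm_num

theorem IsLargeScale.sqrt_le (h : IsLargeScale L y) : √(Real.log y / √y) ≤ 1 / 10 ^ 3 := by
  rw [Real.sqrt_le_left (by norm_num)]
  refine (log_div_sqrt_le exp_two_le h.ge).trans ?_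
  have e1 : √(10 ^ 20 : ℝ) = 10 ^ 10 := by
    rw [show (10 : ℝ) ^ 20 = (10 ^ 10) ^ 2 by norm_num]
    exact Real.sqrt_sq (by norm_num)
  have e2 : Real.log (10 ^ 20) ≤ 180 := by
    rw [Real.log_pow]
    have := Real.log_le_sub_one_of_pos (show (0 : ℝ) < 10 by norm_num)
    push_cast
    linarith
  rw [e1, div_le_iff₀ (by norm_num)]
  refine e2.trans (by norm_num)

theorem IsLargeScale.lossRate_le (h : IsLargeScale L y) : lossRate L y ≤ 1 / 50 := by
  have h1 := h.cube_root_le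
  have h2 := h.sqrt_le
  unfold lossRate
  linarith

theorem IsLargeScale.sqrt_pos (h : IsLargeScale L y) : 0 < √(Real.log y / √y) := by
  have h1 := h.one_le_log
  have h2 := h.pos
  positivity

theorem IsLargeScale.lossRate_pos (h : IsLargeScale L y) : 0 < lossRate L y := by
  have h1 := h.sqrt_pos
  have h2 := h.pos
  have h3 := h.L_ge
  unfold lossRate
  positivity

theorem IsLargeScale.slack_pos (h : IsLargeScale L y) : 0 < slack L y :=
  mul_pos h.pos h.lossRate_pos

theorem IsLargeScale.slack_le (h : IsLargeScale L y) : slack L y ≤ y / 50 := by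
  have := mul_le_mul_of_nonneg_left h.lossRate_le h.pos.le
  unfold slack
  linarith

/-- The cube-root term of `lossRate` exists for this bound: `y * lossRate ^ 3` must dominate `L`, so
that overload has polynomially small probability in `n` when `L = log n`. -/
theorem IsLargeScale.rate_sq (h : IsLargeScale L y) :
    10 ^ 6 * L ≤ lossRate L y ^ 2 * slack L y := by
  have hy := h.pos
  have hL := h.L_ge
  have h1 : 100 * (L / y) ^ (1 / 3 : ℝ) ≤ lossRate L y := by
    unfold lossRate
    linarith [h.sqrt_pos]
  have h0 : 0 ≤ L / y := div_nonneg (by linarith) hy.le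
  have h2 : ((L / y) ^ (1 / 3 : ℝ)) ^ 3 = L / y := by
    rw [← Real.rpow_natCast, ← Real.rpow_mul h0]
    norm_num
  have h3 : (100 * (L / y) ^ (1 / 3 : ℝ)) ^ 3 ≤ lossRate L y ^ 3 := by gcongr
  rw [mul_pow, h2] at h3
  have h4 := mul_le_mul_of_nonneg_left h3 hy.le
  have e : y * (100 ^ 3 * (L / y)) = 10 ^ 6 * L := by field_simp; norm_num
  rw [e] at h4
  unfold slack
  linarith

/-- The other term of `lossRate` exists for this bound: it gives `y * lossRate ^ 4 ≥ 10 ^ 4 * log y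
^ 2`, hence an exponential of at most `1 / y`, which lies below `lossRate ^ 3 / 128`. -/
theorem IsLargeScale.exp_rate (h : IsLargeScale L y) :
    Real.exp (-(lossRate L y ^ 3 * slack L y / 5120)) ≤ lossRate L y ^ 3 / 128 := by
  have hy := h.pos
  have hlog := h.one_le_log
  have hL := h.L_ge
  set s := √(Real.log y / √y) with hs
  have hs0 : 0 < s := h.sqrt_pos
  have hs1 : s ≤ 1 := h.sqrt_le.trans (by norm_num)
  have h1 : 10 * s ≤ lossRate L y := by
    have : 0 ≤ (L / y) ^ (1 / 3 : ℝ) := by positivity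
    unfold lossRate
    linarith
  have hs4 : s ^ 4 = Real.log y ^ 2 / y := by
    have e1 : s ^ 2 = Real.log y / √y := Real.sq_sqrt (by positivity)
    have e2 : √y ^ 2 = y := Real.sq_sqrt hy.le
    rw [show s ^ 4 = (s ^ 2) ^ 2 by ring, e1, div_pow, e2]
  have h2 : (10 * s) ^ 4 ≤ lossRate L y ^ 4 := by gcongr
  have h3 : (10 * s) ^ 3 ≤ lossRate L y ^ 3 := by gcongr
  have h4 : 10 ^ 4 * Real.log y ^ 2 ≤ lossRate L y ^ 3 * slack L y := by
    have := mul_le_mul_of_nonneg_left h2 hy.le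
    rw [mul_pow, hs4] at this
    have e : y * (10 ^ 4 * (Real.log y ^ 2 / y)) = 10 ^ 4 * Real.log y ^ 2 := by field_simp
    unfold slack
    linarith
  have h5 : Real.exp (-(lossRate L y ^ 3 * slack L y / 5120)) ≤ 1 / y := by
    have e : 1 / y = Real.exp (-Real.log y) := by rw [Real.exp_neg, Real.exp_log hy, one_div]
    rw [e, Real.exp_le_exp]
    nlinarith
  refine h5.trans ?_
  have h6 : 1 / y ≤ s ^ 3 := by
    have a1 : s ^ 4 ≤ s ^ 3 := pow_le_pow_of_le_one hs0.le hs1 (by norm_num)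
    rw [hs4] at a1
    refine le_trans ?_ a1
    gcongr
    nlinarith
  have h7 : 0 < s ^ 3 := by positivity
  nlinarith

theorem mul_sqrt_log_div (hy : 0 < y) (hl : 0 ≤ Real.log y) :
    y * √(Real.log y / √y) = y ^ (3 / 4 : ℝ) * Real.log y ^ (1 / 2 : ℝ) := by
  rw [Real.sqrt_div hl, ← Real.sqrt_eq_rpow (Real.log y), Real.sqrt_eq_rpow y, Real.sqrt_eq_rpow (y ^ _),
    ← Real.rpow_mul hy.le, mul_div_assoc', mul_div_right_comm]
  congr 1
  rw [div_eq_iff (by positivity), ← Real.rpow_add hy]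
  norm_num

theorem mul_cube_root_div (hy : 0 < y) (hL : 0 ≤ L) :
    y * (L / y) ^ (1 / 3 : ℝ) = y ^ (2 / 3 : ℝ) * L ^ (1 / 3 : ℝ) := by
  rw [Real.div_rpow hL hy.le, mul_div_assoc', mul_div_right_comm]
  congr 1
  rw [div_eq_iff (by positivity), ← Real.rpow_add hy]
  norm_num

theorem slack_eq (hL : 0 ≤ L) (hy : 1 ≤ y) : slack L y =
    10 * (y ^ (3 / 4 : ℝ) * Real.log y ^ (1 / 2 : ℝ)) +
      100 * (y ^ (2 / 3 : ℝ) * L ^ (1 / 3 : ℝ)) := by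
  have hy0 : 0 < y := by linarith
  rw [← mul_sqrt_log_div hy0 (Real.log_nonneg hy), ← mul_cube_root_div hy0 hL]
  unfold slack lossRate
  ring

theorem slack_mono (hL : 0 ≤ L) (hy : 1 ≤ y) (hyz : y ≤ z) : slack L y ≤ slack L z := by
  rw [slack_eq hL hy, slack_eq hL (hy.trans hyz)]
  have h0 := Real.log_nonneg hy
  have h1 := Real.log_le_log (by linarith) hyz
  have h2 : 0 ≤ z := by linarith
  gcongr

theorem IsLargeScale.slack_mono (h : IsLargeScale L y) (hyz : y ≤ z) : slack L y ≤ slack L z :=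
  _root_.slack_mono (by linarith [h.L_ge]) (by linarith [h.ge]) hyz

theorem IsLargeScale.slack_mul_le (h : IsLargeScale L y) {a : ℝ} (ha : 1 ≤ a) :
    slack L (a * y) ≤ a * slack L y := by
  have h1 : y ≤ a * y := by nlinarith [h.pos]
  have := mul_le_mul_of_nonneg_left (h.lossRate_anti h1) (by nlinarith [h.pos] : 0 ≤ a * y)
  unfold slack
  linarith

theorem IsLargeScale.le_slack (h : IsLargeScale L y) : 100 * L ≤ slack L y := by
  have hy := h.pos
  have hL := h.L_ge
  have h0 : 0 < L / y := by positivity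
  have h1 : L / y ≤ 1 := by
    rw [div_le_one hy]
    linarith [h.ge_mul]
  have h2 : L / y ≤ (L / y) ^ (1 / 3 : ℝ) := by
    have := Real.rpow_le_rpow_of_exponent_ge h0 h1 (show (1 / 3 : ℝ) ≤ 1 by norm_num)
    rwa [Real.rpow_one] at this
  have h3 : 100 * (L / y) ≤ lossRate L y := by
    unfold lossRate
    linarith [h.sqrt_pos]
  have h4 := mul_le_mul_of_nonneg_left h3 hy.le
  have e : y * (100 * (L / y)) = 100 * L := by field_simp
  unfold slack
  linarith

/-- Bernoulli's inequality for `(1 - 1 / y) ^ p`, multiplied by `y ^ p`. -/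
theorem mul_rpow_le_sub {p : ℝ} (hp0 : 0 ≤ p) (hp1 : p ≤ 1) (hy : 1 ≤ y) :
    p * y ^ (p - 1) ≤ y ^ p - (y - 1) ^ p := by
  have hy0 : 0 < y := by linarith
  have h1 : (1 + -(1 / y)) ^ p ≤ 1 + p * -(1 / y) :=
    rpow_one_add_le_one_add_mul_self (by
      rw [neg_le_neg_iff, div_le_one hy0]; exact hy) hp0 hp1
  have h2 : (y - 1) ^ p = y ^ p * (1 + -(1 / y)) ^ p := by
    rw [← Real.mul_rpow hy0.le (by
      rw [← sub_eq_add_neg, sub_nonneg, div_le_one hy0]; exact hy)]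
    congr 1
    field_simp
    ring
  have h3 : y ^ (p - 1) = y ^ p * (1 / y) := by
    rw [Real.rpow_sub_one hy0.ne']; ring
  have h4 : 0 ≤ y ^ p := by positivity
  rw [h2, h3]
  nlinarith

theorem sum_rpow_le {p : ℝ} (hp0 : 0 < p) (hp1 : p ≤ 1) (hy : 1 ≤ y) (m : ℕ) :
    ∑ j ∈ Finset.range m, (y + j) ^ (p - 1) ≤ p⁻¹ * (y + m) ^ p := by
  -- The shift by `-1` makes the differences telescope.
  have h : ∀ m : ℕ, p * ∑ j ∈ Finset.range m, (y + j) ^ (p - 1) ≤ (y + m - 1) ^ p := by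
    intro m
    induction m with
    | zero =>
      simp only [Finset.range_zero, Finset.sum_empty, mul_zero]
      exact Real.rpow_nonneg (by push_cast; linarith) _
    | succ m ih =>
      rw [Finset.sum_range_succ, mul_add]
      have := mul_rpow_le_sub hp0.le hp1 (y := y + m) (by
        have : (0 : ℝ) ≤ m := Nat.cast_nonneg m
        linarith)
      push_cast
      rw [show y + (m + 1 : ℝ) - 1 = y + m by ring]
      linarith
  rw [inv_mul_eq_div, le_div_iff₀ hp0, mul_comm]
  refine (h m).trans ?_
  have : (0 : ℝ) ≤ m := Nat.cast_nonneg m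
  apply Real.rpow_le_rpow <;> linarith

/-- With the logarithm replaced by its final value, the two power sums cost the factors `4 / 3` and
`3 / 2`, both at most `2`. -/
theorem IsLargeScale.sum_lossRate_le (h : IsLargeScale L y) (m : ℕ) :
    ∑ j ∈ Finset.range m, lossRate L (y + j) ≤ 2 * slack L (y + m) := by
  have hy := h.pos
  have hL := h.L_ge
  have hy1 : 1 ≤ y := by linarith [h.ge]
  have hm : (0 : ℝ) ≤ m := Nat.cast_nonneg m
  have hterm : ∀ j ∈ Finset.range m, lossRate L (y + j) ≤
      10 * Real.log (y + m) ^ (1 / 2 : ℝ) * (y + j) ^ (3 / 4 - 1 : ℝ) +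
        100 * L ^ (1 / 3 : ℝ) * (y + j) ^ (2 / 3 - 1 : ℝ) := by
    intro j hj
    have hj0 : (0 : ℝ) ≤ j := Nat.cast_nonneg j
    have hjm : (j : ℝ) ≤ m := by exact_mod_cast (Finset.mem_range.1 hj).le
    have hyj : 0 < y + j := by linarith
    have h1 := slack_eq (L := L) (y := y + j) (by linarith) (by linarith)
    have h2 : lossRate L (y + j) = slack L (y + j) / (y + j) := by
      unfold slack; field_simp
    have h3 : Real.log (y + j) ^ (1 / 2 : ℝ) ≤ Real.log (y + m) ^ (1 / 2 : ℝ) := by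
      have := Real.log_nonneg (show 1 ≤ y + j by linarith)
      gcongr
    rw [h2, h1, Real.rpow_sub_one hyj.ne', Real.rpow_sub_one hyj.ne', add_div]
    have h4 : 0 ≤ (y + j) ^ (3 / 4 : ℝ) / (y + j) := by positivity
    have h5 := mul_le_mul_of_nonneg_left h3 h4
    apply add_le_add
    · calc _ = 10 * ((y + j) ^ (3 / 4 : ℝ) / (y + j) * Real.log (y + j) ^ (1 / 2 : ℝ)) := by ring
        _ ≤ 10 * ((y + j) ^ (3 / 4 : ℝ) / (y + j) * Real.log (y + m) ^ (1 / 2 : ℝ)) := by linarith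
        _ = _ := by ring
    · apply le_of_eq; ring
  refine (Finset.sum_le_sum hterm).trans ?_
  rw [Finset.sum_add_distrib, ← Finset.mul_sum, ← Finset.mul_sum, slack_eq (by linarith)
    (by linarith)]
  have s1 := sum_rpow_le (p := 3 / 4) (by norm_num) (by norm_num) hy1 m
  have s2 := sum_rpow_le (p := 2 / 3) (by norm_num) (by norm_num) hy1 m
  have c1 : 0 ≤ Real.log (y + m) ^ (1 / 2 : ℝ) :=
    Real.rpow_nonneg (Real.log_nonneg (by linarith)) _
  have c2 : 0 ≤ L ^ (1 / 3 : ℝ) := by positivity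
  have t1 := mul_le_mul_of_nonneg_left s1 c1
  have t2 := mul_le_mul_of_nonneg_left s2 c2
  have p1 : 0 ≤ Real.log (y + m) ^ (1 / 2 : ℝ) * (y + m) ^ (3 / 4 : ℝ) := by positivity
  have p2 : 0 ≤ L ^ (1 / 3 : ℝ) * (y + m) ^ (2 / 3 : ℝ) := by positivity
  norm_num at t1 t2 ⊢
  nlinarith

theorem IsLargeScale.rates (h : IsLargeScale L y) :
    Rates (fun i => lossRate L (y + i)) (fun i => slack L (y + i)) := by
  have hi : ∀ i : ℕ, IsLargeScale L (y + i) := fun i => h.mono (by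
    have : (0 : ℝ) ≤ i := Nat.cast_nonneg i
    linarith)
  refine ⟨fun i => (hi i).lossRate_pos, fun i => (hi i).lossRate_le.trans (by norm_num),
    fun i => le_trans ?_ (hi i).rate_sq, fun i => (hi i).exp_rate⟩
  linarith [h.L_ge]

/-- As long as an edge with `d` colors participates, its remaining number of colors is explicit. -/
theorem IsLargeScale.remaining_eq (h : IsLargeScale L y) {d : ℝ} {i : ℕ}
    (hi : slack L (y + i) ≤ remaining (fun i => lossRate L (y + i)) (fun i => slack L (y + i)) d i) :
    remaining (fun i => lossRate L (y + i)) (fun i => slack L (y + i)) d i =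
      d - i + 2 * ∑ j ∈ Finset.range i, lossRate L (y + j) := by
  induction i with
  | zero => simp [remaining]
  | succ i ih =>
    have hyi : IsLargeScale L (y + i) := h.mono (by
      have : (0 : ℝ) ≤ i := Nat.cast_nonneg i
      linarith)
    have hmono : slack L (y + i) ≤ slack L (y + (i + 1 : ℕ)) := hyi.slack_mono (by
      push_cast; linarith)
    have hprev : slack L (y + i) ≤ remaining (fun i => lossRate L (y + i))
        (fun i => slack L (y + i)) d i := by
      rw [remaining] at hi
      split_ifs at hi with hc
      · exact hc
      · exact hmono.trans hi
    rw [remaining, if_pos hprev, ih hprev, Finset.sum_range_succ]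
    push_cast
    ring

theorem IsLargeScale.sum_lossRate_le_div (h : IsLargeScale L y) (m : ℕ) :
    ∑ j ∈ Finset.range m, lossRate L (y + j) ≤ m / 50 := by
  refine (Finset.sum_le_sum (g := fun _ => (1 / 50 : ℝ)) fun j _ => ?_).trans_eq (by
    simp; ring)
  refine (h.mono ?_).lossRate_le
  have : (0 : ℝ) ≤ j := Nat.cast_nonneg j
  linarith

/-- A participating edge has `0 < d - i + 2 * ∑ lossRate`. The crude bound `1 / 50` on the rates
gives `i ≤ 5 / 4 * d`, hence `y + i ≤ 3 * d`. Then the sum is at most `2 * slack L (3 * d) ≤ 6 *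
slack L d`. -/
theorem IsLargeScale.round_le (h : IsLargeScale L y) {d : ℝ} (hd : y ≤ d) {i : ℕ}
    (hi : slack L (y + i) ≤ remaining (fun i => lossRate L (y + i)) (fun i => slack L (y + i)) d i) :
    (i : ℝ) ≤ 5 / 4 * d ∧ i ≤ d + 12 * slack L d := by
  have h1 := h.remaining_eq hi
  have hi0 : (0 : ℝ) ≤ i := Nat.cast_nonneg i
  have hyi : IsLargeScale L (y + i) := h.mono (by linarith)
  have h2 := h.sum_lossRate_le_div i
  have h3 := hyi.slack_pos
  have h4 : (i : ℝ) ≤ 5 / 4 * d := by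
    have := h.pos
    linarith
  refine ⟨h4, ?_⟩
  have h5 := h.sum_lossRate_le i
  have h6 : slack L (y + i) ≤ slack L (3 * d) := hyi.slack_mono (by linarith)
  have h7 := (h.mono hd).slack_mul_le (show (1 : ℝ) ≤ 3 by norm_num)
  linarith

/-- An edge that drops out has fewer remaining colors than the slack at a scale below `3 * d`, and
the number is frozen from then on. -/
theorem IsLargeScale.remaining_le (h : IsLargeScale L y) {d : ℝ} (hd : y ≤ d) (i : ℕ) :
    slack L (y + i) ≤ remaining (fun i => lossRate L (y + i)) (fun i => slack L (y + i)) d i ∨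
      remaining (fun i => lossRate L (y + i)) (fun i => slack L (y + i)) d i ≤ 3 * slack L d := by
  induction i with
  | zero =>
    left
    have := h.slack_le
    have := h.pos
    simp only [remaining, Nat.cast_zero, add_zero]
    linarith
  | succ i ih =>
    by_cases hc : slack L (y + i) ≤ remaining (fun i => lossRate L (y + i))
        (fun i => slack L (y + i)) d i
    · rw [or_iff_not_imp_left]
      intro hn
      have h1 := (h.round_le hd hc).1
      have hi0 : (0 : ℝ) ≤ i := Nat.cast_nonneg i
      have h2 := (h.mono hd).ge
      refine (not_le.1 hn).le.trans ?_
      refine ((h.mono (z := y + (i + 1 : ℕ)) (by push_cast; linarith)).slack_mono ?_).trans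
        ((h.mono hd).slack_mul_le (show (1 : ℝ) ≤ 3 by norm_num))
      push_cast
      linarith
    · right
      rw [remaining, if_neg hc]
      exact ih.resolve_left hc

theorem IsLargeScale.remaining_final (h : IsLargeScale L y) {d : ℝ} (hd : y ≤ d) {K : ℕ}
    (hK : 2 * d ≤ K) :
    remaining (fun i => lossRate L (y + i)) (fun i => slack L (y + i)) d K ≤ 3 * slack L d := by
  refine (h.remaining_le hd K).resolve_left fun hc => ?_
  have := (h.round_le hd hc).1
  have := (h.mono hd).pos
  linarith

end Schedule

/-! ### Later arrivals do not influence earlier decisions -/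

section Prefix

variable {V ι : Type}

theorem matchTree_all_of_request_eq_zero (lab : Sym2 V → ι) (A : ℝ) (x : Sym2 V → ℝ) (X : V → ℝ)
    (l : List (Sym2 V)) : (matchTree lab A x X l).All fun S => ∀ e ∈ l, x e = 0 → e ∈ S := by
  induction l generalizing X with
  | nil => simp [matchTree, CoinTree.All]
  | cons e l ih =>
    refine ⟨fun hp => (ih _).mono fun S hS f hf hxf => ?_, (ih _).bind fun S hS f hf hxf => ?_⟩
    · rcases List.mem_cons.1 hf with rfl | hf
      · simp [matchProb, hxf] at hp
      · exact hS f hf hxf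
    · rcases List.mem_cons.1 hf with rfl | hf
      · exact List.mem_cons_self
      · exact List.mem_cons_of_mem _ (hS f hf hxf)

theorem matchTree_run_append (lab : Sym2 V → ι) (A : ℝ) (x : Sym2 V → ℝ) (X : V → ℝ)
    (l m : List (Sym2 V)) (ω : ι → unitInterval) :
    ∃ r, r.Sublist m ∧
      (matchTree lab A x X (l ++ m)).run ω = (matchTree lab A x X l).run ω ++ r := by
  induction l generalizing X with
  | nil => exact ⟨_, ((matchTree_all lab A x X m).run ω).1, rfl⟩
  | cons e l ih =>
    simp only [List.cons_append, matchTree, CoinTree.run, CoinTree.run_bind]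
    split_ifs
    · exact ih _
    · obtain ⟨r, hr, h⟩ := ih (scaleWeight (matchProb A x X e) X e)
      exact ⟨r, hr, by rw [h]; rfl⟩

/-- This makes the round-by-round program an online algorithm: with fixed seeds, later edges only
append to each list of survivors. -/
theorem roundsTree_run_append (lab : ℕ → Sym2 V → ι) (lam q : ℕ → ℝ) (d : Sym2 V → ℝ)
    (l m : List (Sym2 V)) (ω : ι → unitInterval) (k : ℕ) :
    ∃ r, r.Sublist m ∧
      (roundsTree lab lam q d (l ++ m) k).run ω = (roundsTree lab lam q d l k).run ω ++ r := by
  induction k with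
  | zero => exact ⟨m, List.Sublist.refl m, rfl⟩
  | succ k ih =>
    obtain ⟨r, hr, h⟩ := ih
    simp only [roundsTree, CoinTree.run_bind, h]
    obtain ⟨r', hr', h'⟩ := matchTree_run_append (lab k) (4 / lam k)
      (fun e => request lam q (d e) k) (fun _ => 1) ((roundsTree lab lam q d l k).run ω) r ω
    exact ⟨r', hr'.trans hr, h'⟩

end Prefix

/-! ### Greedy coloring of the survivors -/

section Greedy

variable {V : Type}

open Classical in
/-- Colors the edges of a list greedily with the smallest possible color in `R`. -/
noncomputable def greedyColor (R : Set ℕ) (S : List (Sym2 V)) : Sym2 V → ℕ :=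
  S.foldl (fun c e => Function.update c e
    (sInf {r | r ∈ R ∧ ∀ f, f ≠ e → (∃ v, v ∈ e ∧ v ∈ f) → c f ≠ r})) fun _ => 0

theorem greedyColor_append_of_notMem (R : Set ℕ) (S T : List (Sym2 V)) {e : Sym2 V}
    (he : e ∉ T) : greedyColor R (S ++ T) e = greedyColor R S e := by
  classical
  induction T using List.reverseRecOn with
  | nil => simp
  | append_singleton T f ih =>
    rw [List.mem_append, not_or, List.mem_singleton] at he
    rw [← ih he.1, ← List.append_assoc]
    conv_lhs => unfold greedyColor
    rw [List.foldl_append, List.foldl_cons, List.foldl_nil, Function.update_of_ne he.2]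
    rfl

theorem greedyColor_of_notMem (R : Set ℕ) {S : List (Sym2 V)} {e : Sym2 V} (he : e ∉ S) :
    greedyColor R S e = 0 := by
  simpa [greedyColor] using greedyColor_append_of_notMem R [] S he

-- Edges not yet colored carry the default `0`, which is not in `R`, so only adjacent edges of `S`
-- block a color, and `F` has more colors than these.
open Classical in
theorem greedyColor_spec {R : Set ℕ} (hR : 0 ∉ R) {S : List (Sym2 V)} (hS : S.Nodup)
    {m : Sym2 V → ℕ} (h : ∀ e ∈ S, ∃ F : Finset ℕ, (∀ r ∈ F, r ∈ R ∧ r < m e) ∧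
      (S.toFinset.filter fun f => f ≠ e ∧ ∃ v, v ∈ e ∧ v ∈ f).card < F.card) :
    ∀ e ∈ S, greedyColor R S e ∈ R ∧ greedyColor R S e < m e ∧
      ∀ f ∈ S, f ≠ e → (∃ v, v ∈ e ∧ v ∈ f) → greedyColor R S f ≠ greedyColor R S e := by
  induction S using List.reverseRecOn with
  | nil => simp
  | append_singleton S a ih =>
    have hS' : S.Nodup := hS.sublist (List.sublist_append_left S [a])
    have haS : a ∉ S := fun ha => by
      have := List.nodup_append.1 hS
      exact this.2.2 a ha a (by simp) rfl
    have hih := ih hS' fun e he => by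
      obtain ⟨F, hF, hc⟩ := h e (List.mem_append_left _ he)
      refine ⟨F, hF, lt_of_le_of_lt (Finset.card_le_card ?_) hc⟩
      refine Finset.filter_subset_filter _ ?_
      intro f hf
      simp only [List.mem_toFinset, List.mem_append] at hf ⊢
      exact Or.inl hf
    have hold : ∀ f ∈ S, greedyColor R (S ++ [a]) f = greedyColor R S f := fun f hf =>
      greedyColor_append_of_notMem R S [a] (by
        rw [List.mem_singleton]
        rintro rfl
        exact haS hf)
    set T := {r | r ∈ R ∧ ∀ f, f ≠ a → (∃ v, v ∈ a ∧ v ∈ f) → greedyColor R S f ≠ r} with hT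
    have hnew : greedyColor R (S ++ [a]) a = sInf T := by
      conv_lhs => unfold greedyColor
      rw [List.foldl_append, List.foldl_cons, List.foldl_nil, Function.update_self]
      rfl
    obtain ⟨F, hF, hc⟩ := h a (by simp)
    obtain ⟨r, hrF, hr⟩ := Finset.exists_mem_notMem_of_card_lt_card
      (lt_of_le_of_lt Finset.card_image_le hc : ((((S ++ [a]).toFinset.filter
        fun f => f ≠ a ∧ ∃ v, v ∈ a ∧ v ∈ f).image (greedyColor R S)).card < F.card))
    have hrT : r ∈ T := by
      refine ⟨(hF r hrF).1, fun f hfa hv hfr => ?_⟩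
      by_cases hf : f ∈ S
      · exact hr (Finset.mem_image.2 ⟨f, by simp [hf, hfa, hv], hfr⟩)
      · rw [greedyColor_of_notMem R hf] at hfr
        exact hR (hfr ▸ (hF r hrF).1)
    have hmem : sInf T ∈ T := Nat.sInf_mem ⟨r, hrT⟩
    intro e he
    rw [List.mem_append, List.mem_singleton] at he
    rcases he with he | rfl
    · rw [hold e he]
      refine ⟨(hih e he).1, (hih e he).2.1, fun f hf hfe hv => ?_⟩
      rw [List.mem_append, List.mem_singleton] at hf
      rcases hf with hf | rfl
      · rw [hold f hf]
        exact (hih e he).2.2 f hf hfe hv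
      · rw [hnew]
        obtain ⟨v, hve, hvf⟩ := hv
        exact (hmem.2 e hfe.symm ⟨v, hvf, hve⟩).symm
    · rw [hnew]
      refine ⟨hmem.1, (Nat.sInf_le hrT).trans_lt (hF r hrF).2, fun f hf hfe hv => ?_⟩
      rw [List.mem_append, List.mem_singleton] at hf
      rw [hold f (hf.resolve_right hfe)]
      exact hmem.2 f hfe hv

end Greedy

/-! ### Skipped colors, lifetimes and adjacent edges -/

section Counting

/-- The values between `1` and `φ i` that a strictly increasing `φ` leaves out. -/
theorem card_gaps {φ : ℕ → ℕ} (hφ : StrictMono φ) (i : ℕ) :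
    ∃ F : Finset ℕ, (∀ r ∈ F, r ∈ {r | 1 ≤ r ∧ r ∉ Set.range φ} ∧ r < φ i) ∧
      φ i ≤ F.card + i + 1 := by
  classical
  refine ⟨Finset.Ico 1 (φ i) \ (Finset.range i).image φ, fun r hr => ?_, ?_⟩
  · rw [Finset.mem_sdiff, Finset.mem_Ico] at hr
    refine ⟨⟨hr.1.1, ?_⟩, hr.1.2⟩
    rintro ⟨j, rfl⟩
    exact hr.2 (Finset.mem_image_of_mem φ (Finset.mem_range.2 (hφ.lt_iff_lt.1 hr.1.2)))
  · have h1 := Finset.le_card_sdiff ((Finset.range i).image φ) (Finset.Ico 1 (φ i))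
    have h2 : ((Finset.range i).image φ).card ≤ i :=
      Finset.card_image_le.trans (Finset.card_range i).le
    rw [Nat.card_Ico] at h1
    omega

open Classical in
/-- The number of steps through which a decreasing property persists is the last index at which it
holds. -/
theorem card_persist {P : ℕ → Prop} (hP : ∀ i, P (i + 1) → P i) (h0 : P 0) {K : ℕ} (hK : ¬ P K) :
    P (∑ i ∈ Finset.range K, if P (i + 1) then 1 else 0) ∧
      ¬ P ((∑ i ∈ Finset.range K, if P (i + 1) then 1 else 0) + 1) := by
  have key : ∀ m, (P m ∧ (∑ i ∈ Finset.range m, if P (i + 1) then 1 else 0) = m) ∨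
      (¬ P m ∧ P (∑ i ∈ Finset.range m, if P (i + 1) then 1 else 0) ∧
        ¬ P ((∑ i ∈ Finset.range m, if P (i + 1) then 1 else 0) + 1)) := by
    intro m
    induction m with
    | zero => exact Or.inl ⟨h0, by simp⟩
    | succ m ih =>
      rw [Finset.sum_range_succ]
      by_cases hm : P (m + 1)
      · rcases ih with ⟨-, h2⟩ | ⟨h1, -⟩
        · exact Or.inl ⟨hm, by simp [hm, h2]⟩
        · exact absurd (hP m hm) h1
      · right
        simp only [hm, if_false, add_zero, not_false_eq_true, true_and]
        rcases ih with ⟨h1, h2⟩ | ⟨-, h2⟩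
        · rw [h2]; exact ⟨h1, hm⟩
        · exact h2
  exact ((key K).resolve_left fun h => hK h.1).2

variable {V : Type} [Fintype V]

open Classical in
theorem sum_starWeight_one (S : List (Sym2 V)) (u : V) :
    ∑ w, starWeight (fun _ => 1) S u w =
      ((Finset.univ.filter fun w => s(u, w) ∈ S).card : ℝ) := by
  rw [Finset.card_filter]
  push_cast
  rfl

open Classical in
theorem card_adjacent_le (S : List (Sym2 V)) (u v : V) :
    ((S.toFinset.filter fun f => f ≠ s(u, v) ∧ ∃ w, w ∈ s(u, v) ∧ w ∈ f).card : ℝ) ≤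
      ∑ w, starWeight (fun _ => 1) S u w + ∑ w, starWeight (fun _ => 1) S v w := by
  rw [sum_starWeight_one, sum_starWeight_one]
  norm_cast
  refine (Finset.card_le_card (t := (Finset.univ.filter fun w => s(u, w) ∈ S).image (fun w => s(u, w)) ∪
    (Finset.univ.filter fun w => s(v, w) ∈ S).image (fun w => s(v, w))) ?_).trans
    ((Finset.card_union_le _ _).trans (add_le_add Finset.card_image_le Finset.card_image_le))
  intro f hf
  rw [Finset.mem_filter, List.mem_toFinset] at hf
  obtain ⟨hfS, -, w, hw, hwf⟩ := hf
  obtain ⟨z, rfl⟩ := hwf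
  rcases Sym2.mem_iff.1 hw with rfl | rfl
  · exact Finset.mem_union_left _ (Finset.mem_image.2 ⟨z, by simpa using hfS, rfl⟩)
  · exact Finset.mem_union_right _ (Finset.mem_image.2 ⟨z, by simpa using hfS, rfl⟩)

end Counting

/-! ### The algorithm and its deterministic guarantees -/

section Algorithm

/-- The smallest scale that the coloring algorithm distinguishes. -/
noncomputable def baseScale (n : ℕ) : ℕ := ⌈10 ^ 21 * Real.log n⌉₊

/-- The number of rounds of the coloring algorithm. -/
noncomputable def numRounds (n : ℕ) : ℕ := 2 * max n (baseScale n)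

/-- The degree information, truncated to the relevant range. -/
noncomputable def clippedDegree {n : ℕ} (D : Fin n → ℕ) (v : Fin n) : ℕ :=
  max (min (D v) n) (baseScale n)

/-- The color class of round `i`. -/
noncomputable def roundColor (n i : ℕ) : ℕ :=
  i + 1 + ⌈20 * slack (Real.log n) (baseScale n + i)⌉₊

/-- The colors that are reserved for the edges which survive all rounds. -/
def reservedColors (n : ℕ) : Set ℕ := {r | 1 ≤ r ∧ r ∉ Set.range (roundColor n)}

/-- The labels of the seeds: pairs of a round and an edge. -/
abbrev SeedLabel (n : ℕ) : Type := Fin (numRounds n + 1) × Sym2 (Fin n)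

/-- The seed that `e` uses in round `i`. -/
noncomputable def seedLabel (n : ℕ) (i : ℕ) (e : Sym2 (Fin n)) : SeedLabel n := (Fin.ofNat _ i, e)

/-- The program computing the survivors of the first `m` rounds. -/
noncomputable def survivorTree {n : ℕ} (D : Fin n → ℕ) (es : List (Sym2 (Fin n))) (m : ℕ) :
    CoinTree (SeedLabel n) (List (Sym2 (Fin n))) :=
  roundsTree (seedLabel n) (fun i => lossRate (Real.log n) (baseScale n + i))
    (fun i => slack (Real.log n) (baseScale n + i)) (fun e => (dMax (clippedDegree D) e : ℝ)) es m

open Classical in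
/-- The number of rounds that `e` survives. -/
noncomputable def roundsSurvived {n : ℕ} (D : Fin n → ℕ) (ω : SeedLabel n → unitInterval)
    (es : List (Sym2 (Fin n))) (e : Sym2 (Fin n)) : ℕ :=
  ∑ i ∈ Finset.range (numRounds n), if e ∈ (survivorTree D es (i + 1)).run ω then 1 else 0

open Classical in
/-- The color of `e` when the edges arrive in the order `es`. -/
noncomputable def edgeColor {n : ℕ} (D : Fin n → ℕ) (ω : SeedLabel n → unitInterval)
    (es : List (Sym2 (Fin n))) (e : Sym2 (Fin n)) : ℕ :=
  if e ∈ (survivorTree D es (numRounds n)).run ω then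
    greedyColor (reservedColors n) ((survivorTree D es (numRounds n)).run ω) e
  else roundColor n (roundsSurvived D ω es e)

theorem measurable_edgeColor {n : ℕ} (D : Fin n → ℕ) (es : List (Sym2 (Fin n)))
    (e : Sym2 (Fin n)) : Measurable fun ω => edgeColor D ω es e := by
  classical
  unfold edgeColor
  refine Measurable.ite ?_ ?_ ?_
  · exact CoinTree.measurableSet_run _ {S : List (Sym2 (Fin n)) | e ∈ S}
  · exact CoinTree.measurable_run _ fun S => greedyColor (reservedColors n) S e
  · refine (measurable_from_top (f := roundColor n)).comp ?_
    unfold roundsSurvived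
    exact Finset.measurable_sum _ fun i _ =>
      CoinTree.measurable_run _ fun S => if e ∈ S then 1 else 0

/-- The online edge coloring algorithm. -/
noncomputable def localColoring (n : ℕ) : OnlineEdgeColoringAlgorithm (Fin n) where
  Seed := SeedLabel n → unitInterval
  law := CoinTree.seedLaw (SeedLabel n)
  color D ω past e := edgeColor D ω (past ++ [e]) e
  measurable_color D past e := measurable_edgeColor D (past ++ [e]) e

theorem edgeColor_append {n : ℕ} (D : Fin n → ℕ) (ω : SeedLabel n → unitInterval)
    (l m : List (Sym2 (Fin n))) {e : Sym2 (Fin n)} (he : e ∉ m) :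
    edgeColor D ω (l ++ m) e = edgeColor D ω l e := by
  have hmem : ∀ k, ∃ r, e ∉ r ∧ (survivorTree D (l ++ m) k).run ω =
      (survivorTree D l k).run ω ++ r := by
    intro k
    obtain ⟨r, hr, h⟩ := roundsTree_run_append (seedLabel n)
      (fun i => lossRate (Real.log n) (baseScale n + i))
      (fun i => slack (Real.log n) (baseScale n + i)) (fun e => (dMax (clippedDegree D) e : ℝ))
      l m ω k
    exact ⟨r, fun hh => he (hr.subset hh), h⟩
  have hiff : ∀ k, e ∈ (survivorTree D (l ++ m) k).run ω ↔ e ∈ (survivorTree D l k).run ω := by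
    intro k
    obtain ⟨r, hr, h⟩ := hmem k
    rw [h, List.mem_append, or_iff_left hr]
  obtain ⟨r, hr, h⟩ := hmem (numRounds n)
  unfold edgeColor roundsSurvived
  simp only [hiff]
  rw [h, greedyColor_append_of_notMem _ _ _ hr]

theorem localColoring_output {n : ℕ} (D : Fin n → ℕ) {es : List (Sym2 (Fin n))}
    (hn : es.Nodup) {e : Sym2 (Fin n)} (he : e ∈ es) (ω : SeedLabel n → unitInterval) :
    (localColoring n).output D es ω e = edgeColor D ω es e := by
  have hi : es.idxOf e < es.length := List.idxOf_lt_length_iff.2 he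
  have hsplit : es = (es.take (es.idxOf e) ++ [e]) ++ es.drop (es.idxOf e + 1) := by
    conv_lhs => rw [← List.take_append_drop (es.idxOf e) es]
    rw [List.append_assoc, List.drop_eq_getElem_cons hi, List.getElem_idxOf hi]
    rfl
  have hnot : e ∉ es.drop (es.idxOf e + 1) := by
    intro hh
    rw [hsplit] at hn
    exact (List.nodup_append.1 hn).2.2 e (by simp) e hh rfl
  have := edgeColor_append D ω (es.take (es.idxOf e) ++ [e]) _ hnot
  rw [← hsplit] at this
  exact this.symm

variable {n : ℕ}

theorem isLargeScale_baseScale (hn : 2 ≤ n) : IsLargeScale (Real.log n) (baseScale n) := by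
  have h2 : Real.log 2 ≤ Real.log n := Real.log_le_log (by norm_num) (by exact_mod_cast hn)
  have h3 := Real.log_two_gt_d9
  have h4 : 10 ^ 21 * Real.log n ≤ baseScale n := Nat.le_ceil _
  exact ⟨by linarith, by linarith, by linarith⟩

theorem IsLargeScale.add_nat {L y : ℝ} (h : IsLargeScale L y) (i : ℕ) : IsLargeScale L (y + i) :=
  h.mono (by
    have : (0 : ℝ) ≤ i := Nat.cast_nonneg i
    linarith)

theorem roundColor_strictMono (hn : 2 ≤ n) : StrictMono (roundColor n) := by
  refine strictMono_nat_of_lt_succ fun i => ?_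
  have h := ((isLargeScale_baseScale hn).add_nat i).slack_mono
    (show (baseScale n : ℝ) + i ≤ baseScale n + (i + 1 : ℕ) by push_cast; linarith)
  have := Nat.ceil_le_ceil (mul_le_mul_of_nonneg_left h (by norm_num : (0 : ℝ) ≤ 20))
  unfold roundColor
  omega

theorem baseScale_le_clippedDegree (D : Fin n → ℕ) (v : Fin n) :
    (baseScale n : ℝ) ≤ clippedDegree D v := by
  exact_mod_cast le_max_right _ _

theorem clippedDegree_le_dMax (D : Fin n → ℕ) {v : Fin n} {e : Sym2 (Fin n)} (hv : v ∈ e) :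
    (clippedDegree D v : ℝ) ≤ dMax (clippedDegree D) e := by
  obtain ⟨w, rfl⟩ := hv
  exact_mod_cast le_max_left (clippedDegree D v) (clippedDegree D w)

theorem dMax_clippedDegree (D : Fin n → ℕ) (e : Sym2 (Fin n)) :
    dMax (clippedDegree D) e = max (min (dMax D e) n) (baseScale n) := by
  induction e using Sym2.ind with
  | _ u v =>
    simp only [dMax, Sym2.lift_mk, clippedDegree]
    omega

theorem baseScale_le_dMax (D : Fin n → ℕ) (e : Sym2 (Fin n)) :
    (baseScale n : ℝ) ≤ dMax (clippedDegree D) e := by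
  rw [dMax_clippedDegree]
  exact_mod_cast le_max_right _ _

theorem two_mul_dMax_le (D : Fin n → ℕ) (e : Sym2 (Fin n)) :
    2 * (dMax (clippedDegree D) e : ℝ) ≤ (numRounds n : ℕ) := by
  rw [dMax_clippedDegree]
  unfold numRounds
  norm_cast
  omega

/-- A bound on the color of an edge of clipped degree `d`. -/
theorem roundColor_le (hn : 2 ≤ n) {d : ℝ} (hd : baseScale n ≤ d) {i : ℕ}
    (hi1 : (i : ℝ) ≤ 5 / 4 * d) (hi2 : i ≤ d + 12 * slack (Real.log n) d) :
    (roundColor n i : ℝ) ≤ d + 72 * slack (Real.log n) d + 2 := by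
  have hL := isLargeScale_baseScale hn
  have hi0 : (0 : ℝ) ≤ i := Nat.cast_nonneg i
  have h1 : slack (Real.log n) (baseScale n + i) ≤ slack (Real.log n) (3 * d) :=
    (hL.add_nat i).slack_mono (by linarith [(hL.mono hd).pos])
  have h2 := (hL.mono hd).slack_mul_le (show (1 : ℝ) ≤ 3 by norm_num)
  have h3 := Nat.ceil_lt_add_one (mul_nonneg (by norm_num : (0 : ℝ) ≤ 20)
    (hL.add_nat i).slack_pos.le)
  unfold roundColor
  push_cast
  linarith

/-- If the clipped degree exceeds `baseScale`, `72 * slack` has coefficients `720` and `7200`, below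
`10 ^ 5`. Otherwise everything is a multiple of `baseScale`, plus a constant, and the logarithmic
term absorbs it. -/
theorem le_localColorBound (hn : 2 ≤ n) (d : ℕ) :
    ((max (min d n) (baseScale n) : ℕ) : ℝ) +
      72 * slack (Real.log n) (max (min d n) (baseScale n) : ℕ) + 2 ≤ localColorBound n d := by
  have hL := isLargeScale_baseScale hn
  have hlog := hL.L_ge
  have hlogd : 0 ≤ Real.log d := Real.log_natCast_nonneg d
  unfold localColorBound
  rcases le_total (baseScale n) (min d n) with h | h
  · rw [max_eq_left h]
    have h1 : (min d n : ℕ) ≤ d := min_le_left _ _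
    have h1' : ((min d n : ℕ) : ℝ) ≤ d := by exact_mod_cast h1
    have h2 : IsLargeScale (Real.log n) (min d n : ℕ) := hL.mono (by exact_mod_cast h)
    have h3 := h2.slack_mono h1'
    rw [slack_eq (y := (d : ℝ)) (by linarith) (by linarith [h2.ge])] at h3
    have p1 : 0 ≤ (d : ℝ) ^ (3 / 4 : ℝ) * Real.log d ^ (1 / 2 : ℝ) := by positivity
    have p2 : 0 ≤ (d : ℝ) ^ (2 / 3 : ℝ) * Real.log n ^ (1 / 3 : ℝ) := by positivity
    linarith
  · rw [max_eq_right h]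
    have h1 := hL.slack_le
    have h2 := Nat.ceil_lt_add_one (mul_nonneg (by norm_num : (0 : ℝ) ≤ 10 ^ 21)
      (by linarith : 0 ≤ Real.log n))
    have h3 : (baseScale n : ℝ) ≤ 10 ^ 21 * Real.log n + 1 := h2.le
    have p1 : 0 ≤ (d : ℝ) ^ (3 / 4 : ℝ) * Real.log d ^ (1 / 2 : ℝ) := by positivity
    have p2 : 0 ≤ (d : ℝ) ^ (2 / 3 : ℝ) * Real.log n ^ (1 / 3 : ℝ) := by positivity
    have p3 : (0 : ℝ) ≤ d := Nat.cast_nonneg d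
    linarith

/-- Few edges at every vertex survive all rounds. -/
def FewSurvivors (D : Fin n → ℕ) (S : List (Sym2 (Fin n))) : Prop :=
  ∀ u, ∑ w, starWeight (fun _ => 1) S u w ≤ 9 * slack (Real.log n) (clippedDegree D u)

/-- The two endpoints block at most `9 + 9` slacks of colors, while `roundColor` skips at least `20`
slacks below the index `dMax (clippedDegree D) e`. -/
theorem greedyColor_survivors (hn : 2 ≤ n) (D : Fin n → ℕ) {S : List (Sym2 (Fin n))}
    (hS : S.Nodup) (hfew : FewSurvivors D S) :
    ∀ e ∈ S, greedyColor (reservedColors n) S e ∈ reservedColors n ∧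
      greedyColor (reservedColors n) S e < roundColor n (dMax (clippedDegree D) e) ∧
      ∀ f ∈ S, f ≠ e → (∃ v, v ∈ e ∧ v ∈ f) →
        greedyColor (reservedColors n) S f ≠ greedyColor (reservedColors n) S e := by
  classical
  have hL := isLargeScale_baseScale hn
  refine greedyColor_spec (fun h => absurd h.1 (by norm_num)) hS fun e _ => ?_
  obtain ⟨F, hF, hcard⟩ := card_gaps (roundColor_strictMono hn) (dMax (clippedDegree D) e)
  refine ⟨F, hF, ?_⟩
  have hd := baseScale_le_dMax D e
  have h1 : 20 * slack (Real.log n) (dMax (clippedDegree D) e) ≤ F.card := by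
    have h2 : ⌈20 * slack (Real.log n) (baseScale n + dMax (clippedDegree D) e)⌉₊ ≤ F.card := by
      unfold roundColor at hcard
      omega
    have h3 := (hL.mono hd).slack_mono (z := baseScale n + dMax (clippedDegree D) e)
      (by linarith [hL.pos])
    refine le_trans ?_ ((Nat.le_ceil _).trans (Nat.cast_le.2 h2))
    linarith
  have h4 : ∀ v ∈ e, slack (Real.log n) (clippedDegree D v) ≤
      slack (Real.log n) (dMax (clippedDegree D) e) := fun v hv =>
    (hL.mono (baseScale_le_clippedDegree D v)).slack_mono (clippedDegree_le_dMax D hv)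
  have h5 := (hL.mono hd).slack_pos
  rw [← Nat.cast_lt (α := ℝ)]
  refine lt_of_lt_of_le ?_ h1
  induction e using Sym2.ind with
  | _ u v =>
    refine lt_of_le_of_lt (le_of_eq_of_le ?_ (card_adjacent_le S u v)) ?_
    · congr!
    have := hfew u
    have := hfew v
    have := h4 u (by simp)
    have := h4 v (by simp)
    linarith

theorem survivorTree_run_sublist (D : Fin n → ℕ) (es : List (Sym2 (Fin n))) (m : ℕ)
    (ω : SeedLabel n → unitInterval) : ((survivorTree D es m).run ω).Sublist es :=
  (roundsTree_all _ _ _ _ es m).run ω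

theorem survivorTree_run_succ (D : Fin n → ℕ) (es : List (Sym2 (Fin n))) (m : ℕ)
    (ω : SeedLabel n → unitInterval) :
    IsMatchedOut ((survivorTree D es m).run ω) ((survivorTree D es (m + 1)).run ω) := by
  unfold survivorTree
  rw [roundsTree, CoinTree.run_bind]
  exact (matchTree_all _ _ _ _ _).run ω

/-- An edge that is colored in some round was still participating. -/
theorem slack_le_remaining (D : Fin n → ℕ) (es : List (Sym2 (Fin n))) {m : ℕ}
    (ω : SeedLabel n → unitInterval) {e : Sym2 (Fin n)} (h1 : e ∈ (survivorTree D es m).run ω)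
    (h2 : e ∉ (survivorTree D es (m + 1)).run ω) :
    slack (Real.log n) (baseScale n + m) ≤
      remaining (fun i => lossRate (Real.log n) (baseScale n + i))
        (fun i => slack (Real.log n) (baseScale n + i)) (dMax (clippedDegree D) e) m := by
  by_contra hc
  apply h2
  unfold survivorTree
  rw [roundsTree, CoinTree.run_bind]
  exact (matchTree_all_of_request_eq_zero _ _ _ _ _).run ω e h1 (by simp [request, hc])

theorem survived_spec (D : Fin n → ℕ) {es : List (Sym2 (Fin n))}
    (ω : SeedLabel n → unitInterval) {e : Sym2 (Fin n)} (he : e ∈ es)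
    (hK : e ∉ (survivorTree D es (numRounds n)).run ω) :
    e ∈ (survivorTree D es (roundsSurvived D ω es e)).run ω ∧
      e ∉ (survivorTree D es (roundsSurvived D ω es e + 1)).run ω := by
  have := card_persist (P := fun i => e ∈ (survivorTree D es i).run ω)
    (fun i hi => (survivorTree_run_succ D es i ω).1.subset hi) he hK
  unfold roundsSurvived
  convert this

/-- Equal round colors mean the same round, whose edges form a matching; reserved colors are never
round colors; two survivors are handled by the greedy rule. -/
theorem edgeColor_proper (hn : 2 ≤ n) (D : Fin n → ℕ) {es : List (Sym2 (Fin n))}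
    (hnd : es.Nodup) (ω : SeedLabel n → unitInterval)
    (hfew : FewSurvivors D ((survivorTree D es (numRounds n)).run ω)) {e f : Sym2 (Fin n)}
    (he : e ∈ es) (hf : f ∈ es) (hef : e ≠ f) (hv : ∃ v, v ∈ e ∧ v ∈ f) :
    edgeColor D ω es e ≠ edgeColor D ω es f := by
  have hS := hnd.sublist (survivorTree_run_sublist D es (numRounds n) ω)
  have hg := greedyColor_survivors hn D hS hfew
  unfold edgeColor
  split_ifs with h1 h2 h2
  · obtain ⟨v, hve, hvf⟩ := hv
    exact (hg f h2).2.2 e h1 hef ⟨v, hvf, hve⟩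
  · exact fun hh => (hg e h1).1.2 ⟨_, hh.symm⟩
  · exact fun hh => (hg f h2).1.2 ⟨_, hh⟩
  · intro hh
    have hh' := (roundColor_strictMono hn).injective hh
    have s1 := survived_spec D ω he h1
    have s2 := survived_spec D ω hf h2
    rw [← hh'] at s2
    obtain ⟨v, hve, hvf⟩ := hv
    exact hef ((survivorTree_run_succ D es _ ω).2 v e s1.1 f s2.1 hve hvf s1.2 s2.2)

theorem edgeColor_bound (hn : 2 ≤ n) (D : Fin n → ℕ) {es : List (Sym2 (Fin n))}
    (hnd : es.Nodup) (ω : SeedLabel n → unitInterval)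
    (hfew : FewSurvivors D ((survivorTree D es (numRounds n)).run ω)) {e : Sym2 (Fin n)}
    (he : e ∈ es) :
    1 ≤ edgeColor D ω es e ∧ (edgeColor D ω es e : ℝ) ≤ localColorBound n (dMax D e) := by
  have hL := isLargeScale_baseScale hn
  have hS := hnd.sublist (survivorTree_run_sublist D es (numRounds n) ω)
  have hg := greedyColor_survivors hn D hS hfew
  have hd := baseScale_le_dMax D e
  have hb := le_localColorBound hn (dMax D e)
  rw [← dMax_clippedDegree] at hb
  unfold edgeColor
  split_ifs with h1
  · refine ⟨(hg e h1).1.1, le_trans ?_ hb⟩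
    have hp := (hL.mono hd).slack_pos
    have := roundColor_le hn hd (i := dMax (clippedDegree D) e)
      (by linarith [(hL.mono hd).pos]) (by linarith)
    exact (Nat.cast_le.2 (hg e h1).2.1.le).trans this
  · refine ⟨by unfold roundColor; omega, le_trans ?_ hb⟩
    have s1 := survived_spec D ω he h1
    have := hL.round_le hd (slack_le_remaining D es ω s1.1 s1.2)
    exact roundColor_le hn hd this.1 this.2

end Algorithm

/-! ### Success probability and the asymptotic form -/

section Final

variable {n : ℕ}

open Classical in
theorem card_star_le {G : SimpleGraph (Fin n)} [DecidableRel G.Adj] {D : Fin n → ℕ}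
    {es : List (Sym2 (Fin n))} (hD : ∀ v, G.degree v ≤ D v) (hes : G.IsArrivalOrder es)
    (u : Fin n) :
    ((Finset.univ.filter fun w => s(u, w) ∈ es).card : ℝ) ≤ clippedDegree D u := by
  have h1 : (Finset.univ.filter fun w => s(u, w) ∈ es) = G.neighborFinset u := by
    ext w
    simp [hes.2]
  rw [h1, SimpleGraph.card_neighborFinset_eq_degree]
  have h2 : G.degree u ≤ n := (G.degree_lt_card_verts u).le.trans_eq (Fintype.card_fin n)
  exact_mod_cast (le_min (hD u) h2).trans (le_max_left _ _)

/-- A sum over the edges at `u` is at most the clipped degree times a bound on the terms. -/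
theorem sum_starWeight_le {G : SimpleGraph (Fin n)} [DecidableRel G.Adj] {D : Fin n → ℕ}
    {es : List (Sym2 (Fin n))} (hD : ∀ v, G.degree v ≤ D v) (hes : G.IsArrivalOrder es)
    {u : Fin n} {x : Sym2 (Fin n) → ℝ} {b : ℝ} (hb : 0 ≤ b) (hx : ∀ e, u ∈ e → x e ≤ b) :
    ∑ w, starWeight x es u w ≤ clippedDegree D u * b := by
  classical
  have h1 : ∑ w, starWeight x es u w ≤ ∑ w, starWeight (fun _ => 1) es u w * b := by
    refine Finset.sum_le_sum fun w _ => ?_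
    unfold starWeight
    split_ifs
    · rw [one_mul]
      exact hx _ (Sym2.mem_mk_left u w)
    · rw [zero_mul]
  rw [← Finset.sum_mul, sum_starWeight_one] at h1
  refine h1.trans (mul_le_mul_of_nonneg_right ?_ hb)
  refine le_of_eq_of_le ?_ (card_star_le hD hes u)
  congr!

theorem exp_neg_log_eq (hn : 2 ≤ n) : Real.exp (-(100 * Real.log n)) = ((n : ℝ) ^ 100)⁻¹ := by
  have : (0 : ℝ) < n := by positivity
  rw [Real.exp_neg, show (100 : ℝ) * Real.log n = ((100 : ℕ) : ℝ) * Real.log n by norm_num,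
    Real.exp_nat_mul, Real.exp_log this]

theorem failure_sum_le (hn : 2 ≤ n) :
    ((numRounds n : ℕ) + 1 : ℝ) * n * Real.exp (-(100 * Real.log n)) ≤ (n : ℝ) ^ (-1 : ℝ) := by
  have hn2 : (2 : ℝ) ≤ n := by exact_mod_cast hn
  have hn0 : (0 : ℝ) < n := by linarith
  have h1 : (baseScale n : ℝ) ≤ 10 ^ 21 * n + 1 := by
    have h2 := Real.log_le_sub_one_of_pos hn0
    have h3 := Nat.ceil_lt_add_one (mul_nonneg (by norm_num : (0 : ℝ) ≤ 10 ^ 21)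
      (Real.log_natCast_nonneg n))
    unfold baseScale
    linarith
  have h2 : ((numRounds n : ℕ) + 1 : ℝ) ≤ 10 ^ 22 * n := by
    unfold numRounds
    push_cast
    have : max (n : ℝ) (baseScale n) ≤ 10 ^ 21 * n + 1 := max_le (by linarith) h1
    linarith
  -- Of the exponent `100`, two powers of `n` pay for the rounds and vertices, and one is the
  -- claimed failure probability.
  have h3 : (10 : ℝ) ^ 22 ≤ (n : ℝ) ^ 97 :=
    le_trans (by norm_num : (10 : ℝ) ^ 22 ≤ 2 ^ 97) (by gcongr)
  rw [exp_neg_log_eq hn, Real.rpow_neg_one]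
  have h4 : (0 : ℝ) < (n : ℝ) ^ 100 := by positivity
  rw [← div_eq_mul_inv, div_le_iff₀ h4]
  have h5 : (n : ℝ)⁻¹ * (n : ℝ) ^ 100 = (n : ℝ) ^ 97 * n * n := by field_simp
  rw [h5]
  have : ((numRounds n : ℕ) + 1 : ℝ) * n ≤ (10 ^ 22 * n) * n := by gcongr
  refine this.trans ?_
  gcongr

open Classical in
theorem fewSurvivors_prob (hn : 2 ≤ n) {G : SimpleGraph (Fin n)} [DecidableRel G.Adj]
    {D : Fin n → ℕ} {es : List (Sym2 (Fin n))} (hD : ∀ v, G.degree v ≤ D v)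
    (hes : G.IsArrivalOrder es) :
    1 - (n : ℝ) ^ (-1 : ℝ) ≤ (CoinTree.seedLaw (SeedLabel n)).real
      {ω | FewSurvivors D ((survivorTree D es (numRounds n)).run ω)} := by
  have hL := isLargeScale_baseScale hn
  have hK0 : 0 < numRounds n := by
    unfold numRounds; omega
  have hfresh := roundsTree_fresh (lab := seedLabel n) (fun i => lossRate (Real.log n) (baseScale n + i))
    (fun i => slack (Real.log n) (baseScale n + i)) (fun e => (dMax (clippedDegree D) e : ℝ))
    hes.1 (K := numRounds n) (fun i hi j hj e f hef => by
      simp only [seedLabel, Prod.mk.injEq] at hef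
      refine ⟨?_, hef.2⟩
      have := congrArg Fin.val hef.1
      simpa [Fin.ofNat, Nat.mod_eq_of_lt (show i < numRounds n + 1 by omega),
        Nat.mod_eq_of_lt (show j < numRounds n + 1 by omega)] using this) le_rfl
  have hdpos : ∀ e, (0 : ℝ) < dMax (clippedDegree D) e := fun e =>
    hL.pos.trans_le (baseScale_le_dMax D e)
  have hDpos : ∀ u, (0 : ℝ) < clippedDegree D u := fun u =>
    hL.pos.trans_le (baseScale_le_clippedDegree D u)
  have hbad := hL.rates.ex_rounds_large_le (K := numRounds n)
    (d := fun e => (dMax (clippedDegree D) e : ℝ)) hdpos (seedLabel n) (S := es)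
    (fun f hf => G.not_isDiag_of_mem_edgeSet ((hes.2 f).1 hf)) hes.1
    (fun u => by
      refine (sum_starWeight_le hD hes (b := 1 / clippedDegree D u) (by positivity)
        fun e he => ?_).trans_eq (mul_one_div_cancel (hDpos u).ne')
      exact one_div_le_one_div_of_le (hDpos u) (clippedDegree_le_dMax D he))
    -- An edge at `u` ends with a remaining fraction of at most `3 * lossRate` at its own scale,
    -- which is at least that of `u`. As `lossRate` decreases, the bound is local to `u`.
    (Q := fun u => 3 * slack (Real.log n) (clippedDegree D u))
    (fun u => by
      have hu := hL.mono (baseScale_le_clippedDegree D u)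
      refine (sum_starWeight_le hD hes (b := 3 * lossRate (Real.log n) (clippedDegree D u))
        (by linarith [hu.lossRate_pos]) fun e he => ?_).trans_eq (by unfold slack; ring)
      have h1 := hL.remaining_final (baseScale_le_dMax D e) (two_mul_dMax_le D e)
      have h2 := hu.lossRate_anti (clippedDegree_le_dMax D he)
      rw [div_le_iff₀ (hdpos e)]
      refine h1.trans ?_
      have := mul_le_mul_of_nonneg_right h2 (hdpos e).le
      unfold slack
      linarith)
    (δ := Real.exp (-(100 * Real.log n)))
    (fun i _ => by
      rw [Real.exp_le_exp]
      have := (hL.add_nat i).rate_sq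
      have := hL.L_ge
      linarith)
    (fun u => by
      rw [Real.exp_le_exp]
      have := (hL.mono (baseScale_le_clippedDegree D u)).le_slack
      have := hL.L_ge
      linarith)
  rw [Fintype.card_fin] at hbad
  set B : Set (List (Sym2 (Fin n))) := {S | ¬ FewSurvivors D S} with hB
  have hrun := CoinTree.Fresh.seedLaw_run hfresh B
  have hind : B.indicator (1 : List (Sym2 (Fin n)) → ℝ) = fun S => if ∃ u,
      3 * (3 * slack (Real.log n) (clippedDegree D u)) < ∑ w, starWeight (fun _ => 1) S u w
      then 1 else 0 := by
    funext S
    have : S ∈ B ↔ ∃ u, 3 * (3 * slack (Real.log n) (clippedDegree D u)) <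
        ∑ w, starWeight (fun _ => 1) S u w := by
      simp only [hB, FewSurvivors, Set.mem_ofPred_eq, not_forall, not_le]
      refine exists_congr fun u => ?_
      rw [show 3 * (3 * slack (Real.log n) (clippedDegree D u)) =
        9 * slack (Real.log n) (clippedDegree D u) by ring]
    rw [Set.indicator_apply]
    exact if_congr this rfl rfl
  have hle : (CoinTree.seedLaw (SeedLabel n)).real
      {ω | (survivorTree D es (numRounds n)).run ω ∈ B} ≤ (n : ℝ) ^ (-1 : ℝ) := by
    refine (hrun.trans_le ?_).trans (failure_sum_le hn)
    rw [hind]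
    convert hbad
  have hcompl := probReal_compl_eq_one_sub (μ := CoinTree.seedLaw (SeedLabel n))
    (CoinTree.measurableSet_run (survivorTree D es (numRounds n)) B)
  have hset : {ω | (survivorTree D es (numRounds n)).run ω ∈ B}ᶜ =
      {ω | FewSurvivors D ((survivorTree D es (numRounds n)).run ω)} := by
    ext ω
    simp [hB]
  rw [← hset, hcompl]
  linarith

theorem localColoring_prob (n : ℕ) (G : SimpleGraph (Fin n)) [DecidableRel G.Adj]
    (D : Fin n → ℕ) (es : List (Sym2 (Fin n))) (hD : ∀ v, G.degree v ≤ D v)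
    (hes : G.IsArrivalOrder es) :
    1 - (n : ℝ) ^ (-1 : ℝ) ≤ (localColoring n).law.real
      {ω | G.IsProperEdgeColoring ((localColoring n).output D es ω) ∧
        ∀ e ∈ G.edgeSet, 1 ≤ (localColoring n).output D es ω e ∧
          ((localColoring n).output D es ω e : ℝ) ≤ localColorBound n (dMax D e)} := by
  rcases Nat.lt_or_ge n 2 with hn | hn
  · have hempty : ∀ e, e ∉ G.edgeSet := by
      intro e
      induction e using Sym2.ind with
      | _ u v =>
        intro he
        have hne : u ≠ v := SimpleGraph.Adj.ne he
        have := Fin.val_ne_of_ne hne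
        omega
    have huniv : {ω | G.IsProperEdgeColoring ((localColoring n).output D es ω) ∧
        ∀ e ∈ G.edgeSet, 1 ≤ (localColoring n).output D es ω e ∧
          ((localColoring n).output D es ω e : ℝ) ≤ localColorBound n (dMax D e)} = Set.univ := by
      ext ω
      simp only [Set.mem_ofPred_eq, Set.mem_univ, iff_true]
      exact ⟨fun e he => absurd he (hempty e), fun e he => absurd he (hempty e)⟩
    rw [huniv, probReal_univ]
    have : 0 ≤ (n : ℝ) ^ (-1 : ℝ) := by positivity
    linarith
  · refine (fewSurvivors_prob hn hD hes).trans ?_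
    refine measureReal_mono (μ := CoinTree.seedLaw (SeedLabel n)) ?_
    intro ω hω
    refine ⟨fun e he f hf hef hv => ?_, fun e he => ?_⟩
    · rw [localColoring_output D hes.1 ((hes.2 e).2 he),
        localColoring_output D hes.1 ((hes.2 f).2 hf)]
      exact edgeColor_proper hn D hes.1 ω hω ((hes.2 e).2 he) ((hes.2 f).2 hf) hef hv
    · rw [localColoring_output D hes.1 ((hes.2 e).2 he)]
      exact edgeColor_bound hn D hes.1 ω hω ((hes.2 e).2 he)

/-- The relative excess of `localColorBound` at degree `y`. -/
noncomputable def relativeExcess (n : ℕ) (y : ℝ) : ℝ :=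
  2 * 10 ^ 24 * (Real.log n / y) +
    10 ^ 5 * (√(Real.log y / √y) + (Real.log n / y) ^ (1 / 3 : ℝ))

theorem localColorBound_eq (n : ℕ) {d : ℕ} (hd : 1 ≤ d) :
    localColorBound n d = d * (1 + relativeExcess n d) := by
  have hd1 : (1 : ℝ) ≤ d := by exact_mod_cast hd
  have hd0 : (0 : ℝ) < d := by linarith
  unfold localColorBound relativeExcess
  rw [← mul_sqrt_log_div hd0 (Real.log_nonneg hd1),
    ← mul_cube_root_div hd0 (Real.log_natCast_nonneg n)]
  field_simp
  ring

theorem relativeExcess_le {g : ℝ} (hg : Real.exp 2 ≤ g) {d : ℝ} (hd : g ≤ d) :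
    relativeExcess n d ≤ relativeExcess n g := by
  have hg0 : 0 < g := (Real.exp_pos 2).trans_le hg
  have h1 := log_div_sqrt_le hg hd
  have h2 := Real.log_natCast_nonneg n
  have h3 : 0 < d := by linarith
  unfold relativeExcess
  gcongr

/-- A bound uniform in `d`, for those `n` at which `g n` is too small for monotonicity to apply. -/
theorem relativeExcess_le_of_one_le {d : ℝ} (hd : 1 ≤ d) : relativeExcess n d ≤
    2 * 10 ^ 24 * Real.log n + 10 ^ 5 * (√2 + Real.log n ^ (1 / 3 : ℝ)) := by
  have h2 := Real.log_natCast_nonneg n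
  have h3 : Real.log n / d ≤ Real.log n := div_le_self h2 hd
  have h4 : Real.log d / √d ≤ 2 := by
    rw [div_le_iff₀ (by positivity)]
    have := Real.log_le_rpow_div (x := d) (by linarith) (show (0 : ℝ) < 1 / 2 by norm_num)
    rw [← Real.sqrt_eq_rpow] at this
    linarith
  unfold relativeExcess
  gcongr

theorem tendsto_relativeExcess {g : ℕ → ℝ}
    (hg : Tendsto (fun n : ℕ => g n / Real.log n) atTop atTop) :
    Tendsto g atTop atTop ∧ Tendsto (fun n => relativeExcess n (g n)) atTop (𝓝 0) := by
  have hlog : Tendsto (fun n : ℕ => Real.log n) atTop atTop :=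
    Real.tendsto_log_atTop.comp tendsto_natCast_atTop_atTop
  have hgtop : Tendsto g atTop atTop := by
    refine (hg.atTop_mul_atTop₀ hlog).congr' ?_
    filter_upwards [hlog.eventually_gt_atTop 0] with n hn
    rw [div_mul_cancel₀ _ hn.ne']
  refine ⟨hgtop, ?_⟩
  have h1 : Tendsto (fun n : ℕ => Real.log n / g n) atTop (𝓝 0) := by
    refine hg.inv_tendsto_atTop.congr fun n => ?_
    simp [inv_div]
  have h2 : Tendsto (fun n : ℕ => (Real.log n / g n) ^ (1 / 3 : ℝ)) atTop (𝓝 0) := by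
    have := h1.rpow_const (p := 1 / 3) (Or.inr (by norm_num))
    rwa [Real.zero_rpow (by norm_num)] at this
  have h3 : Tendsto (fun y : ℝ => √(Real.log y / √y)) atTop (𝓝 0) := by
    have h4 := (isLittleO_log_rpow_atTop (show (0 : ℝ) < 1 / 2 by norm_num)).tendsto_div_nhds_zero
    simp only [← Real.sqrt_eq_rpow] at h4
    have := (Real.continuous_sqrt.tendsto 0).comp h4
    rwa [Real.sqrt_zero] at this
  have h5 := (h1.const_mul (2 * 10 ^ 24)).add (((h3.comp hgtop).add h2).const_mul (10 ^ 5))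
  simpa [relativeExcess] using h5

/-- Relative form of the bound on the colors, for degrees that are large compared to `log n`. -/
theorem exists_relative_bound {g : ℕ → ℝ}
    (hg : Tendsto (fun n : ℕ => g n / Real.log n) atTop atTop) :
    ∃ h : ℕ → ℝ, Tendsto h atTop (𝓝 0) ∧ ∀ n d : ℕ, 1 ≤ d → g n ≤ d →
      localColorBound n d ≤ d * (1 + h n) := by
  classical
  obtain ⟨h1, h2⟩ := tendsto_relativeExcess hg
  -- The second case concerns only finitely many `n`, since `g` tends to infinity, and does not
  -- affect the limit.
  refine ⟨fun n => if Real.exp 2 ≤ g n then relativeExcess n (g n) else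
    2 * 10 ^ 24 * Real.log n + 10 ^ 5 * (√2 + Real.log n ^ (1 / 3 : ℝ)), h2.congr' ?_, ?_⟩
  · filter_upwards [h1.eventually_ge_atTop (Real.exp 2)] with n hn
    rw [if_pos hn]
  · intro n d hd hgd
    rw [localColorBound_eq n hd]
    gcongr
    beta_reduce
    split_ifs with hc
    · exact relativeExcess_le hc hgd
    · exact relativeExcess_le_of_one_le (by exact_mod_cast hd)

theorem one_le_dMax {G : SimpleGraph (Fin n)} [DecidableRel G.Adj] {D : Fin n → ℕ}
    (hD : ∀ v, G.degree v ≤ D v) {e : Sym2 (Fin n)} (he : e ∈ G.edgeSet) : 1 ≤ dMax D e := by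
  induction e using Sym2.ind with
  | _ u v =>
    have h1 : 0 < G.degree u := (G.degree_pos_iff_exists_adj u).2 ⟨v, he⟩
    exact (Nat.succ_le_of_lt h1).trans ((hD u).trans (le_max_left (D u) (D v)))

end Final

theorem mainTheorem4 :
    ∃ c : ℝ, 0 < c ∧ ∃ A : (n : ℕ) → OnlineEdgeColoringAlgorithm (Fin n),
      -- the explicit bound on the colors
      (∀ (n : ℕ) (G : SimpleGraph (Fin n)) [DecidableRel G.Adj] (D : Fin n → ℕ)
          (es : List (Sym2 (Fin n))),
        (∀ v, G.degree v ≤ D v) → G.IsArrivalOrder es →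
        1 - (n : ℝ) ^ (-c) ≤ (A n).law.real
          {ω | G.IsProperEdgeColoring ((A n).output D es ω) ∧
            ∀ e ∈ G.edgeSet, 1 ≤ (A n).output D es ω e ∧
              ((A n).output D es ω e : ℝ) ≤ localColorBound n (dMax D e)}) ∧
      -- if `d_max(e) = ω(log n)`, then `c(e) ≤ (1 + o(1)) d_max(e)`
      (∀ g : ℕ → ℝ, Tendsto (fun n : ℕ => g n / Real.log n) atTop atTop →
        ∃ h : ℕ → ℝ, Tendsto h atTop (𝓝 0) ∧
          ∀ (n : ℕ) (G : SimpleGraph (Fin n)) [DecidableRel G.Adj] (D : Fin n → ℕ)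
            (es : List (Sym2 (Fin n))),
          (∀ v, G.degree v ≤ D v) → G.IsArrivalOrder es →
          1 - (n : ℝ) ^ (-c) ≤ (A n).law.real
            {ω | G.IsProperEdgeColoring ((A n).output D es ω) ∧
              ∀ e ∈ G.edgeSet, 1 ≤ (A n).output D es ω e ∧
                ((A n).output D es ω e : ℝ) ≤ localColorBound n (dMax D e) ∧
                (g n ≤ (dMax D e : ℝ) →
                  ((A n).output D es ω e : ℝ) ≤ (dMax D e : ℝ) * (1 + h n))}) := by
  refine ⟨1, one_pos, localColoring, fun n G _ D es hD hes => localColoring_prob n G D es hD hes,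
    fun g hg => ?_⟩
  obtain ⟨h, hh, hbound⟩ := exists_relative_bound hg
  refine ⟨h, hh, fun n G _ D es hD hes => (localColoring_prob n G D es hD hes).trans ?_⟩
  refine measureReal_mono fun ω hω => ⟨hω.1, fun e he => ?_⟩
  obtain ⟨h1, h2⟩ := hω.2 e he
  exact ⟨h1, h2, fun hge => h2.trans (hbound n _ (one_le_dMax hD he) hge)⟩
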